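/- For $n\ge 0$ let $\mathcal F_{n,2}=\{\pi\in S_n:\ -1\le \pi(i)-i\le 2 \text{ for all } i\}$ be the set of $2$-Fibonacci permutations, and let $u$ be the uniform distribution on $\mathcal F_{n,2}$. The greedy algorithm $\mathtt A_{g,2}$ constructs a random $\pi\in\mathcal F_{n,2}$ as follows. If $n\le 4$, it selects $\pi\in\mathcal F_{n,2}$ uniformly at random. If $n\ge 5$, then in each step let $i$ be the smallest unmatched index amongst those with the maximal number of remaining allowable choices for the cycle containing $i$ (so $i=3$ in the first step); a uniformly random allowable cycle structure is chosen for the unmatched indices $j\le i$ (that is, the cycles containing these indices are determined, uniformly amongst all possibilities that can be completed to an element of $\mathcal F_{n,2}$ compatible with the previous choices); this continues until $\pi$ is constructed. The treatment of the last few indices is immaterial: for any fixed $c\in\{0,1,2,3,4\}$, one may also stipulate that as soon as at most $c$ indices are undetermined, the algorithm selects one of the remaining compatible permutations uniformly at random ($c=0$: no such rule; $c=4$: the convention for $n\le4$ is applied also to the remaining indices). Let $P_{g,2}(\pi)$ be the probability of $\pi$ under $\mathtt A_{g,2}$, and put $T_{g,2}(\pi)=P_{g,2}(\pi)^{-1}$.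 Then, for each such $c$, with $\pi\in\mathcal F_{n,2}$ random with respect to $u$, as $n\to\infty$, \[ \frac{\log T_{g,2}(\pi)-\mu_{g,2}\,n}{\sigma_{g,2}\sqrt n}\xrightarrow{d}N(0,1), \] where, with $\varphi_2\doteq1.8393$ the real root of $x^3=x^2+x+1$ and $X$ a random variable equal to $3$, $4$, $5$ with probabilities $4/\varphi_2^3$, $3/\varphi_2^4$, $2/\varphi_2^5$ (which sum to $1$), \[ \mu_{g,2}=\frac{\log 9}{\mathbf E(X)},\qquad \sigma_{g,2}>0,\qquad \sigma_{g,2}^2=\frac{\mathrm{Var}(X)}{\mathbf E(X)^3}\,\log^2 9 , \] and numerically $|\mu_{g,2}-0.6365|\le 0.00005$ and $|\sigma_{g,2}^2-0.0514|\le 0.00005$. -/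

import Mathlib

open MeasureTheory ProbabilityTheory Filter Topology

namespace TwoFibonacci

/-- The 2-Fibonacci permutations of `n` indices: `-1 ≤ π(i) - i ≤ 2` for all `i`
(a condition that does not depend on whether the indices start at `0` or at `1`). -/
def perms (n : ℕ) : Finset (Equiv.Perm (Fin n)) :=
  {π | ∀ i, (-1 : ℤ) ≤ ((π i : ℕ) : ℤ) - ((i : ℕ) : ℤ) ∧ ((π i : ℕ) : ℤ) - ((i : ℕ) : ℤ) ≤ 2}

theorem perms_nonempty (n : ℕ) : (perms n).Nonempty := ⟨1, by simp [perms]⟩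

/-! The state of the algorithm is the set `C` of all 2-Fibonacci permutations that are compatible
with the choices made so far. -/

/-- The number of remaining allowable choices for the cycle containing `i`.  (For fixed `i`,
the permutation `π.cycleOf i`, which acts as `π` on the cycle containing `i` and
as the identity elsewhere, determines that cycle and is determined by it.) -/
def numChoices {n : ℕ} (C : Finset (Equiv.Perm (Fin n))) (i : Fin n) : ℕ :=
  (C.image fun π => π.cycleOf i).card

/-- The indices that are neither matched nor forced, i.e. whose cycle is not yet determined. -/
def unmatched {n : ℕ} (C : Finset (Equiv.Perm (Fin n))) : Finset (Fin n) :=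
  {i | 1 < numChoices C i}

/-- `i` is the smallest index with the maximal number of remaining choices for its cycle.
As long as something is left to be determined, such an `i` is automatically unmatched. -/
def IsGreedyIndex {n : ℕ} (C : Finset (Equiv.Perm (Fin n))) (i : Fin n) : Prop :=
  (∀ j, numChoices C j ≤ numChoices C i) ∧ ∀ j < i, numChoices C j < numChoices C i

instance {n : ℕ} (C : Finset (Equiv.Perm (Fin n))) : DecidablePred (IsGreedyIndex C) :=
  fun i => by unfold IsGreedyIndex; infer_instance

/-- The unmatched indices up to and including the greedy index. -/
def block {n : ℕ} (C : Finset (Equiv.Perm (Fin n))) : Finset (Fin n) :=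
  {j ∈ unmatched C | ∃ i, IsGreedyIndex C i ∧ j ≤ i}

/-- The cycle structure of `π` on the unmatched indices up to the greedy index:
the cycle of each of these indices. -/
def cycleStructure {n : ℕ} (C : Finset (Equiv.Perm (Fin n))) (π : Equiv.Perm (Fin n)) :
    block C → Equiv.Perm (Fin n) :=
  fun j => π.cycleOf j

/-- One step of the greedy algorithm: a uniformly random allowable cycle structure is selected for
the unmatched indices up to the greedy index, and the permutations with that structure remain.
If `n ≤ 4`, or if at most `c` indices are unmatched, a uniformly random one of the
remaining permutations is selected instead. -/
noncomputable def step {n : ℕ} (c : ℕ) (C : Finset (Equiv.Perm (Fin n))) :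
    PMF (Finset (Equiv.Perm (Fin n))) :=
  if hC : C.Nonempty then
    if n ≤ 4 ∨ (unmatched C).card ≤ c then
      (PMF.uniformOfFinset C hC).map fun π => {π}
    else
      (PMF.uniformOfFinset (C.image (cycleStructure C)) (hC.image _)).map fun s =>
        {π ∈ C | cycleStructure C π = s}
  else PMF.pure C

/-- The law of the state after `k` steps, started from all 2-Fibonacci permutations. -/
noncomputable def run (n c : ℕ) : ℕ → PMF (Finset (Equiv.Perm (Fin n)))
  | 0 => PMF.pure (perms n)
  | k + 1 => (run n c k).bind (step c)

/-- `P(π)`, the probability that the greedy algorithm constructs `π`.  Each step determines the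
cycle of a new index until a single permutation remains, so `n` steps always suffice;
further steps do not change anything. -/
noncomputable def P (n c : ℕ) (π : Equiv.Perm (Fin n)) : ℝ := (run n c n {π}).toReal

/-- `T(π) = P(π)⁻¹`. -/
noncomputable def T (n c : ℕ) (π : Equiv.Perm (Fin n)) : ℝ := (P n c π)⁻¹

instance (n : ℕ) : MeasurableSpace (Equiv.Perm (Fin n)) := ⊤

/-- The uniform measure on the 2-Fibonacci permutations. -/
noncomputable def uniform (n : ℕ) : Measure (Equiv.Perm (Fin n)) :=
  (PMF.uniformOfFinset (perms n) (perms_nonempty n)).toMeasure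

instance (n : ℕ) : IsProbabilityMeasure (uniform n) :=
  inferInstanceAs (IsProbabilityMeasure (PMF.toMeasure _))

end TwoFibonacci

/-! Call `p` a cut of `π` if `π` preserves the first `p` indices. Between consecutive cuts a
2-Fibonacci permutation is a block of length 1, 2 or 3: its first index goes to its last, every
other index to its predecessor. So these permutations correspond to compositions into parts 1, 2, 3,
counted by `trib`.

The states of the algorithm are cylinders `cyl p π` at cuts `p`. With at least five indices left, `p
+ 2` is the first index with the maximal number, six, of possible cycles. Fixing the cycles up to it
fixes `π` up to its first cut at or beyond `p + 3`. There are nine options (`numOptions_cyl`): four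
consume 3 indices, three consume 4 and two consume 5. Hence `log T` is `log 9` times the number of
such steps, plus a bounded term from the last four indices: a renewal count, with step law `4ψ³,
3ψ⁴, 2ψ⁵` for `ψ = 1/φ`.

The limit law comes from characteristic functions. The exponential sum of `log T` over a cylinder
satisfies a linear recursion (`exists_expSum_eq`). Multiplied by `(ψ e^{-s})^m`, with `s` the
second-order solution of `∑ pₗ exp (w - l s) = 1` at `w = i t log 9`, it stays close to the scaled
count `trib m * ψ^m` (`norm_expSum_sub_le`). For `t = θ / (σ √n)` the accumulated error tends to 0,
while `n s` is exactly the centring phase minus `θ²/2` (`tendsto_expSum`). Lévy's continuity theorem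
concludes. -/

namespace TwoFibonacci

/-! ### Cuts, blocks and the count of 2-Fibonacci permutations. -/

section Combinatorics

variable {n : ℕ} {π π' : Equiv.Perm (Fin n)} {p q : ℕ}

theorem mem_perms_iff :
    π ∈ perms n ↔ ∀ i : Fin n, (i : ℕ) ≤ π i + 1 ∧ (π i : ℕ) ≤ i + 2 := by
  simp only [perms, Finset.mem_filter, Finset.mem_univ, true_and]
  refine forall_congr' fun i => ?_
  omega

/-- `p` is a cut of `π` if `π` maps the first `p` indices to themselves. -/
def IsCut (π : Equiv.Perm (Fin n)) (p : ℕ) : Prop :=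
  ∀ i : Fin n, (i : ℕ) < p → (π i : ℕ) < p

theorem isCut_zero (π : Equiv.Perm (Fin n)) : IsCut π 0 := fun _ h => absurd h (by omega)

theorem IsCut.congr (h : IsCut π p) (e : ∀ i : Fin n, (i : ℕ) < p → π' i = π i) : IsCut π' p :=
  fun i hi => by rw [e i hi]; exact h i hi

/-- An injection of a finite initial segment into itself is onto, so no outside index can enter it.
-/
theorem IsCut.le_apply (h : IsCut π p) {i : Fin n} (hi : p ≤ i) : p ≤ (π i : ℕ) := by
  by_contra! hlt
  let S : Finset (Fin n) := {j | (j : ℕ) < p}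
  have hS : S.map π.toEmbedding = S := by
    refine Finset.eq_of_subset_of_card_le ?_ (by simp)
    intro x hx
    obtain ⟨j, hj, rfl⟩ := Finset.mem_map.1 hx
    simpa [S] using h j (by simpa [S] using hj)
  have : π i ∈ S.map π.toEmbedding := by rw [hS]; simpa [S] using hlt
  obtain ⟨j, hj, hji⟩ := Finset.mem_map.1 this
  have : j = i := π.injective hji
  subst this
  have : (j : ℕ) < p := by simpa [S] using hj
  omega

/-- An index that is not a cut is mapped to its predecessor. -/
theorem apply_of_not_isCut (hπ : π ∈ perms n) {i : Fin n} (h : ¬ IsCut π i) :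
    (π i : ℕ) + 1 = i := by
  unfold IsCut at h
  push Not at h
  obtain ⟨j, hj, hji⟩ := h
  -- Since some index jumps over `i`, some value `v < i` is taken at an index `≥ i`; as values drop
  -- by at most 1, that index is `i` and `v = i - 1`.
  have h2 : ¬ IsCut π⁻¹ i := fun hc => by
    have := hc.le_apply (i := π j) hji
    rw [show π⁻¹ (π j) = j from π.symm_apply_apply j] at this
    omega
  unfold IsCut at h2
  push Not at h2
  obtain ⟨v, hv, hvi⟩ := h2
  have h3 := (mem_perms_iff.1 hπ (π⁻¹ v)).1
  have h6 : π (π⁻¹ v) = v := π.apply_symm_apply v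
  rw [h6] at h3
  have h4 : π⁻¹ v = i := Fin.ext (by omega)
  have h5 : π i = v := by rw [← h4, h6]
  rw [h5]
  rw [h4] at h3
  omega

theorem not_isCut_between {i : Fin n} (hi : (i : ℕ) = p) (h1 : p < q)
    (h2 : q ≤ π i) : ¬ IsCut π q := fun h => by
  have := h i (by omega)
  omega

/-- The block that starts at a cut ends in a cut. -/
theorem IsCut.next (hπ : π ∈ perms n) (hc : IsCut π p) {i : Fin n} (hi : (i : ℕ) = p) :
    IsCut π (π i + 1) := by
  intro j hj
  rcases lt_trichotomy (j : ℕ) p with h | h | h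
  · have := hc j h
    have := hc.le_apply (i := i) (by omega)
    omega
  · have : j = i := Fin.ext (by omega)
    subst this
    omega
  · have := apply_of_not_isCut hπ (not_isCut_between hi h (by omega))
    omega

/-- The permutations in `perms n` that agree with `π` on the first `p` indices. -/
def cyl (p : ℕ) (π : Equiv.Perm (Fin n)) : Finset (Equiv.Perm (Fin n)) :=
  {π' ∈ perms n | ∀ i : Fin n, (i : ℕ) < p → π' i = π i}

theorem mem_cyl : π' ∈ cyl p π ↔ π' ∈ perms n ∧ ∀ i : Fin n, (i : ℕ) < p → π' i = π i := by
  simp [cyl]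

theorem self_mem_cyl (hπ : π ∈ perms n) : π ∈ cyl p π := mem_cyl.2 ⟨hπ, fun _ _ => rfl⟩

theorem cyl_zero (π : Equiv.Perm (Fin n)) : cyl 0 π = perms n := by
  ext; simp [mem_cyl]

theorem cyl_eq_of_mem (h : π' ∈ cyl p π) : cyl p π' = cyl p π := by
  ext τ
  simp only [mem_cyl] at *
  refine and_congr_right fun _ => forall₂_congr fun i hi => ?_
  rw [h.2 i hi]

theorem cyl_top (hπ : π ∈ perms n) : cyl n π = {π} := by
  ext τ
  simp only [mem_cyl, Finset.mem_singleton]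
  constructor
  · rintro ⟨-, h⟩
    ext i
    rw [h i i.2]
  · rintro rfl
    exact ⟨hπ, fun _ _ => rfl⟩

/-- `π` on the first `p` indices and the identity elsewhere. -/
theorem exists_truncate (hπ : π ∈ perms n) (hc : IsCut π p) :
    ∃ σ ∈ perms n, (∀ i : Fin n, (i : ℕ) < p → σ i = π i) ∧
      ∀ i : Fin n, p ≤ (i : ℕ) → σ i = i := by
  have h : ∀ x : Fin n, ((π x : ℕ) < p) ↔ ((x : ℕ) < p) := fun x =>
    ⟨fun hx => by
      by_contra! h'
      have := hc.le_apply h'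
      omega, hc x⟩
  let σ := Equiv.Perm.ofSubtype (π.subtypePerm (p := fun i : Fin n => (i : ℕ) < p) h)
  have h1 : ∀ i : Fin n, (i : ℕ) < p → σ i = π i := fun i hi => by
    simp only [σ]
    rw [Equiv.Perm.ofSubtype_apply_of_mem (p := fun i : Fin n => (i : ℕ) < p) _ hi]
    simp
  have h2 : ∀ i : Fin n, p ≤ (i : ℕ) → σ i = i := fun i hi => by
    simp only [σ]
    exact Equiv.Perm.ofSubtype_apply_of_not_mem _ (by simpa using hi)
  refine ⟨σ, mem_perms_iff.2 fun i => ?_, h1, h2⟩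
  rcases lt_or_ge (i : ℕ) p with hi | hi
  · rw [h1 i hi]; exact mem_perms_iff.1 hπ i
  · rw [h2 i hi]; omega

/-- A prefix that ends in a cut can be continued by a block of any length `a ≤ 3` that fits. -/
theorem exists_child (hπ : π ∈ perms n) (hc : IsCut π p) {a : ℕ} (ha : 1 ≤ a) (ha3 : a ≤ 3)
    (han : p + a ≤ n) :
    ∃ σ ∈ perms n, (∀ i : Fin n, (i : ℕ) < p → σ i = π i) ∧
      ∀ i : Fin n, (i : ℕ) = p → (σ i : ℕ) + 1 = p + a := by
  obtain ⟨σ, hσ, h1, h2⟩ := exists_truncate hπ hc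
  -- It suffices to place the block after an identity prefix: `σ` and `τ` act on complementary index
  -- sets, so their product has both behaviours.
  suffices ∃ τ ∈ perms n, (∀ i : Fin n, (i : ℕ) < p → τ i = i) ∧
      ∀ i : Fin n, (i : ℕ) = p → (τ i : ℕ) + 1 = p + a by
    obtain ⟨τ, hτ, h3, h4⟩ := this
    have hcut : IsCut τ p := fun i hi => by rw [h3 i hi]; exact hi
    have key : ∀ i : Fin n, p ≤ (i : ℕ) → (σ * τ) i = τ i := fun i hi => by
      rw [Equiv.Perm.mul_apply]; exact h2 _ (hcut.le_apply hi)
    have key2 : ∀ i : Fin n, (i : ℕ) < p → (σ * τ) i = σ i := fun i hi => by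
      rw [Equiv.Perm.mul_apply, h3 i hi]
    refine ⟨σ * τ, mem_perms_iff.2 fun i => ?_, fun i hi => by rw [key2 i hi, h1 i hi],
      fun i hi => by rw [key i hi.ge]; exact h4 i hi⟩
    rcases lt_or_ge (i : ℕ) p with hi | hi
    · rw [key2 i hi]; exact mem_perms_iff.1 hσ i
    · rw [key i hi]; exact mem_perms_iff.1 hτ i
  obtain rfl | rfl | rfl : a = 1 ∨ a = 2 ∨ a = 3 := by omega
  · exact ⟨1, mem_perms_iff.2 fun i => by simp only [Equiv.Perm.one_apply]; omega,
      fun i _ => rfl, fun i hi => by simp only [Equiv.Perm.one_apply]; omega⟩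
  · let P : Fin n := ⟨p, by omega⟩
    let P1 : Fin n := ⟨p + 1, by omega⟩
    have hP : (P : ℕ) = p := rfl
    have hP1 : (P1 : ℕ) = p + 1 := rfl
    have hv : ∀ i : Fin n, ((Equiv.swap P P1 i : Fin n) : ℕ) =
        if (i : ℕ) = p then p + 1 else if (i : ℕ) = p + 1 then p else i := fun i => by
      rw [Equiv.swap_apply_def]
      simp only [Fin.ext_iff, hP, hP1]
      split_ifs <;> simp [P, P1]
    refine ⟨Equiv.swap P P1, mem_perms_iff.2 fun i => ?_, fun i hi => Fin.ext ?_,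
      fun i hi => ?_⟩ <;> rw [hv] <;> split_ifs <;> omega
  · let P : Fin n := ⟨p, by omega⟩
    let P1 : Fin n := ⟨p + 1, by omega⟩
    let P2 : Fin n := ⟨p + 2, by omega⟩
    have hP : (P : ℕ) = p := rfl
    have hP1 : (P1 : ℕ) = p + 1 := rfl
    have hP2 : (P2 : ℕ) = p + 2 := rfl
    have hv : ∀ i : Fin n, (((Equiv.swap P1 P2 * Equiv.swap P P1) i : Fin n) : ℕ) =
        if (i : ℕ) = p then p + 2 else if (i : ℕ) = p + 1 then p else
          if (i : ℕ) = p + 2 then p + 1 else i := fun i => by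
      rw [Equiv.Perm.mul_apply, Equiv.swap_apply_def, Equiv.swap_apply_def]
      simp only [Fin.ext_iff, hP, hP1, hP2]
      split_ifs <;> simp_all
    refine ⟨Equiv.swap P1 P2 * Equiv.swap P P1, mem_perms_iff.2 fun i => ?_,
      fun i hi => Fin.ext ?_, fun i hi => ?_⟩ <;> rw [hv] <;> split_ifs <;> omega

open Classical in
/-- A continuation of the first `p` values of `π` by a block of length `a`. -/
noncomputable def child (π : Equiv.Perm (Fin n)) (p a : ℕ) : Equiv.Perm (Fin n) :=
  if h : ∃ σ ∈ perms n, (∀ i : Fin n, (i : ℕ) < p → σ i = π i) ∧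
      ∀ i : Fin n, (i : ℕ) = p → (σ i : ℕ) + 1 = p + a then h.choose else 1

/-- `a` is the length of a block that may follow the first `p` of `n` indices. -/
def IsLength (n p a : ℕ) : Prop := 1 ≤ a ∧ a ≤ 3 ∧ p + a ≤ n

theorem child_spec (hπ : π ∈ perms n) (hc : IsCut π p) {a : ℕ} (ha : IsLength n p a) :
    child π p a ∈ perms n ∧ (∀ i : Fin n, (i : ℕ) < p → child π p a i = π i) ∧
      ∀ i : Fin n, (i : ℕ) = p → (child π p a i : ℕ) + 1 = p + a := by
  have h := exists_child hπ hc ha.1 ha.2.1 ha.2.2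
  rw [child, dif_pos h]
  exact h.choose_spec

theorem child_mem (hπ : π ∈ perms n) (hc : IsCut π p) {a : ℕ} (ha : IsLength n p a) :
    child π p a ∈ perms n := (child_spec hπ hc ha).1

theorem child_mem_cyl (hπ : π ∈ perms n) (hc : IsCut π p) {a : ℕ} (ha : IsLength n p a) :
    child π p a ∈ cyl p π := mem_cyl.2 ⟨child_mem hπ hc ha, (child_spec hπ hc ha).2.1⟩

theorem child_apply (hπ : π ∈ perms n) (hc : IsCut π p) {a : ℕ} (ha : IsLength n p a)
    {i : Fin n} (hi : (i : ℕ) = p) : (child π p a i : ℕ) + 1 = p + a :=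
  (child_spec hπ hc ha).2.2 i hi

theorem isCut_of_mem_cyl (hc : IsCut π p) (h : π' ∈ cyl p π) : IsCut π' p :=
  hc.congr (mem_cyl.1 h).2

theorem isCut_child (hπ : π ∈ perms n) (hc : IsCut π p) {a : ℕ} (ha : IsLength n p a) :
    IsCut (child π p a) (p + a) := by
  have hi : p < n := by have := ha.1; have := ha.2.2; omega
  have h := (isCut_of_mem_cyl hc (child_mem_cyl hπ hc ha)).next (child_mem hπ hc ha)
    (i := ⟨p, hi⟩) rfl
  rwa [child_apply hπ hc ha rfl] at h

/-- If `q` is not beyond the first cut of `π` that is `≥ p`, then the values of `π` on the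
first `p` indices determine those on the first `q` indices. -/
theorem eq_of_agree (hπ : π ∈ perms n) (hπ' : π' ∈ perms n)
    (e : ∀ i : Fin n, (i : ℕ) < p → π' i = π i)
    (hq : ∀ r, p ≤ r → r < q → ¬ IsCut π r) :
    ∀ i : Fin n, (i : ℕ) < q → π' i = π i := by
  intro i
  induction hi : (i : ℕ) using Nat.strong_induction_on generalizing i with
  | _ k ih =>
    intro hk
    rcases lt_or_ge k p with h | h
    · exact e i (by omega)
    · have h1 : ¬ IsCut π k := hq k h hk
      have h2 : ¬ IsCut π' k := fun hc => h1 (hc.congr fun j hj => (ih j hj j rfl (by omega)).symm)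
      subst hi
      have h3 := apply_of_not_isCut hπ h1
      have h4 := apply_of_not_isCut hπ' h2
      exact Fin.ext (by omega)

/-- The value at `p` fixes the whole next block, because the indices inside it are not cuts and go
to their predecessors. -/
theorem cyl_child (hπ : π ∈ perms n) (hc : IsCut π p) {a : ℕ} (ha : IsLength n p a) :
    cyl (p + a) (child π p a) =
      {τ ∈ cyl p π | ∀ i : Fin n, (i : ℕ) = p → (τ i : ℕ) + 1 = p + a} := by
  ext τ
  have hs := child_spec hπ hc ha
  have hp : p < n := by have := ha.1; have := ha.2.2; omega
  simp only [Finset.mem_filter, mem_cyl]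
  constructor
  · rintro ⟨h1, h2⟩
    refine ⟨⟨h1, fun i hi => by rw [h2 i (by omega), hs.2.1 i hi]⟩, fun i hi => ?_⟩
    rw [h2 i (by have := ha.1; omega), hs.2.2 i hi]
  · rintro ⟨⟨h1, h2⟩, h3⟩
    refine ⟨h1, eq_of_agree (p := p + 1) hs.1 h1 (fun i hi => ?_) fun r hr hr2 => ?_⟩
    · rcases Nat.lt_succ_iff_lt_or_eq.1 hi with h | h
      · rw [h2 i h, hs.2.1 i h]
      · have := h3 i h
        have := hs.2.2 i h
        exact Fin.ext (by omega)
    · refine not_isCut_between (p := p) (i := ⟨p, hp⟩) rfl (by omega) ?_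
      have := hs.2.2 ⟨p, hp⟩ rfl
      omega

instance (n p a : ℕ) : Decidable (IsLength n p a) := by unfold IsLength; infer_instance

/-- The cylinder is partitioned by the length of the block at `p`. The general target serves both
cardinalities and complex exponential sums. -/
theorem sum_cyl {M : Type*} [AddCommMonoid M] (hπ : π ∈ perms n) (hc : IsCut π p) (hp : p < n)
    (g : Equiv.Perm (Fin n) → M) :
    ∑ τ ∈ cyl p π, g τ =
      ∑ a ∈ (Finset.Icc 1 3).filter (IsLength n p), ∑ τ ∈ cyl (p + a) (child π p a), g τ := by
  let P : Fin n := ⟨p, hp⟩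
  rw [← Finset.sum_fiberwise_of_maps_to (s := cyl p π)
    (t := (Finset.Icc 1 3).filter (IsLength n p)) (g := fun τ => (τ P : ℕ) + 1 - p)]
  · refine Finset.sum_congr rfl fun a ha => ?_
    have ha := (Finset.mem_filter.1 ha).2
    rw [cyl_child hπ hc ha]
    refine Finset.sum_congr (Finset.filter_congr fun τ hτ => ?_) fun _ _ => rfl
    have h1 := (isCut_of_mem_cyl hc hτ).le_apply (i := P) le_rfl
    constructor
    · intro h i hi
      have : i = P := Fin.ext hi
      subst this
      have := ha.1
      omega
    · intro h
      have := h P rfl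
      omega
  · intro τ hτ
    have h1 := (isCut_of_mem_cyl hc hτ).le_apply (i := P) le_rfl
    have h2 := (mem_perms_iff.1 (mem_cyl.1 hτ).1 P).2
    have h3 : (P : ℕ) = p := rfl
    have := (τ P).2
    simp only [Finset.mem_filter, Finset.mem_Icc, IsLength]
    omega

theorem sum_cyl_of_three_le {M : Type*} [AddCommMonoid M] (hπ : π ∈ perms n) (hc : IsCut π p)
    (hp : p + 3 ≤ n) (g : Equiv.Perm (Fin n) → M) :
    ∑ τ ∈ cyl p π, g τ = ∑ τ ∈ cyl (p + 1) (child π p 1), g τ +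
      ∑ τ ∈ cyl (p + 2) (child π p 2), g τ + ∑ τ ∈ cyl (p + 3) (child π p 3), g τ := by
  rw [sum_cyl hπ hc (by omega)]
  have : (Finset.Icc 1 3).filter (IsLength n p) = {1, 2, 3} := by
    ext a
    simp only [Finset.mem_filter, Finset.mem_Icc, IsLength, Finset.mem_insert,
      Finset.mem_singleton]
    omega
  rw [this]
  simp [add_assoc]

/-- The number of compositions of `m` into parts `1`, `2`, `3`. -/
def trib : ℕ → ℕ
  | 0 => 1
  | 1 => 1
  | 2 => 2
  | m + 3 => trib (m + 2) + trib (m + 1) + trib m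

/-- The size depends only on the number `m` of remaining indices. The cases `m ≤ 2` are separate
because longer blocks do not fit. -/
theorem card_cyl (m : ℕ) : ∀ (p : ℕ) (π : Equiv.Perm (Fin n)), π ∈ perms n → IsCut π p →
    p + m = n → (cyl p π).card = trib m := by
  induction m using Nat.strong_induction_on with
  | _ m ih =>
    intro p π hπ hc hm
    have H : ∀ a, IsLength n p a → a ≤ m → (cyl (p + a) (child π p a)).card = trib (m - a) :=
      fun a ha hma => ih (m - a) (by have := ha.1; omega) _ _ (child_mem hπ hc ha)
        (isCut_child hπ hc ha) (by omega)
    match m with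
    | 0 =>
      have : p = n := by omega
      subst this
      rw [cyl_top hπ]
      simp [trib]
    | 1 =>
      rw [Finset.card_eq_sum_ones, sum_cyl hπ hc (by omega)]
      have : (Finset.Icc 1 3).filter (IsLength n p) = {1} := by
        ext a
        simp only [Finset.mem_filter, Finset.mem_Icc, IsLength, Finset.mem_singleton]
        omega
      rw [this, Finset.sum_singleton, ← Finset.card_eq_sum_ones,
        H 1 ⟨by omega, by omega, by omega⟩ le_rfl]
      simp [trib]
    | 2 =>
      rw [Finset.card_eq_sum_ones, sum_cyl hπ hc (by omega)]
      have : (Finset.Icc 1 3).filter (IsLength n p) = {1, 2} := by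
        ext a
        simp only [Finset.mem_filter, Finset.mem_Icc, IsLength, Finset.mem_insert,
          Finset.mem_singleton]
        omega
      rw [this, Finset.sum_pair (by omega), ← Finset.card_eq_sum_ones, ← Finset.card_eq_sum_ones,
        H 1 ⟨by omega, by omega, by omega⟩ (by omega), H 2 ⟨by omega, by omega, by omega⟩ le_rfl]
      simp [trib]
    | m + 3 =>
      rw [Finset.card_eq_sum_ones, sum_cyl_of_three_le hπ hc (by omega),
        ← Finset.card_eq_sum_ones, ← Finset.card_eq_sum_ones, ← Finset.card_eq_sum_ones,
        H 1 ⟨by omega, by omega, by omega⟩ (by omega),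
        H 2 ⟨by omega, by omega, by omega⟩ (by omega),
        H 3 ⟨by omega, by omega, by omega⟩ (by omega)]
      simp [trib]

end Combinatorics

/-! ### The probability of a permutation as a product of inverse option counts. -/

section Algorithm

variable {n : ℕ} {c k : ℕ} {π : Equiv.Perm (Fin n)} {C C' : Finset (Equiv.Perm (Fin n))}

/-- The number of options between which the algorithm chooses in the state `C`. -/
def numOptions (c : ℕ) (C : Finset (Equiv.Perm (Fin n))) : ℕ :=
  if n ≤ 4 ∨ (unmatched C).card ≤ c then C.card else (C.image (cycleStructure C)).card

/-- The state that follows the state `C` if `π` is constructed in the end. -/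
def nextState (c : ℕ) (π : Equiv.Perm (Fin n)) (C : Finset (Equiv.Perm (Fin n))) :
    Finset (Equiv.Perm (Fin n)) :=
  if n ≤ 4 ∨ (unmatched C).card ≤ c then {π}
  else {π' ∈ C | cycleStructure C π' = cycleStructure C π}

theorem self_mem_nextState (h : π ∈ C) : π ∈ nextState c π C := by
  unfold nextState; split_ifs <;> simp [h]

theorem nextState_subset (h : π ∈ C) : nextState c π C ⊆ C := by
  unfold nextState; split_ifs
  · simpa using h
  · exact Finset.filter_subset _ _

theorem numOptions_pos (h : π ∈ C) : 0 < numOptions c C := by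
  unfold numOptions; split_ifs
  · exact Finset.card_pos.2 ⟨π, h⟩
  · exact Finset.card_pos.2 ⟨_, Finset.mem_image_of_mem _ h⟩

theorem eq_nextState_of_step_ne_zero {A : Finset (Equiv.Perm (Fin n))} (hC : C.Nonempty)
    (h : step c C A ≠ 0) (hA : π ∈ A) : π ∈ C ∧ A = nextState c π C := by
  rw [step, dif_pos hC] at h
  unfold nextState
  split_ifs at h ⊢
  · obtain ⟨a, ha, rfl⟩ := (PMF.mem_support_map_iff _ _ _).1 ((PMF.mem_support_iff _ _).2 h)
    obtain rfl : π = a := by simpa using hA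
    exact ⟨by simpa using ha, rfl⟩
  · obtain ⟨a, ha, rfl⟩ := (PMF.mem_support_map_iff _ _ _).1 ((PMF.mem_support_iff _ _).2 h)
    obtain ⟨h1, rfl⟩ := Finset.mem_filter.1 hA
    exact ⟨h1, rfl⟩

theorem step_nextState (h : π ∈ C) :
    step c C (nextState c π C) = (numOptions c C : ENNReal)⁻¹ := by
  have hC : C.Nonempty := ⟨π, h⟩
  rw [step, dif_pos hC, nextState, numOptions]
  split_ifs
  · rw [PMF.map_apply, tsum_eq_single π]
    · rw [if_pos rfl, PMF.uniformOfFinset_apply, if_pos h]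
    · intro b hb
      rw [if_neg (by simpa using Ne.symm hb)]
  · rw [PMF.map_apply, tsum_eq_single (cycleStructure C π)]
    · rw [if_pos rfl, PMF.uniformOfFinset_apply, if_pos (Finset.mem_image_of_mem _ h)]
    · intro b hb
      rw [if_neg]
      intro he
      have : π ∈ ({π' ∈ C | cycleStructure C π' = b} : Finset _) := by
        rw [← he]; simp [h]
      exact hb (Finset.mem_filter.1 this).2.symm

theorem self_mem_iterate (h : π ∈ C) (k : ℕ) : π ∈ (nextState c π)^[k] C := by
  induction k with
  | zero => exact h
  | succ k ih => rw [Function.iterate_succ_apply']; exact self_mem_nextState ih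

/-- The options of a step split the state into disjoint classes, so a single path of states keeps
`π`, and its probability is the product along the path. -/
theorem run_iterate (hπ : π ∈ perms n) (k : ℕ) :
    (∀ A, run n c k A ≠ 0 → π ∈ A → A = (nextState c π)^[k] (perms n)) ∧
    run n c k ((nextState c π)^[k] (perms n)) =
      ∏ j ∈ Finset.range k, (numOptions c ((nextState c π)^[j] (perms n)) : ENNReal)⁻¹ := by
  induction k with
  | zero => simp [run]
  | succ k ih =>
    obtain ⟨ih1, ih2⟩ := ih
    have hne : ∀ C, run n c k C ≠ 0 → C.Nonempty := by
      clear ih1 ih2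
      induction k with
      | zero =>
        intro C hC
        simp only [run, PMF.pure_apply, ne_eq, ite_eq_right_iff, one_ne_zero, imp_false,
          not_not] at hC
        rw [hC]
        exact perms_nonempty n
      | succ k ih =>
        intro C hC
        obtain ⟨D, hD, hDC⟩ := (PMF.mem_support_bind_iff _ _ _).1 ((PMF.mem_support_iff _ _).2 hC)
        have hD' := ih D hD
        rw [PMF.mem_support_iff, step, dif_pos hD'] at hDC
        split_ifs at hDC
        · obtain ⟨a, ha, rfl⟩ := (PMF.mem_support_map_iff _ _ _).1 ((PMF.mem_support_iff _ _).2 hDC)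
          simp
        · obtain ⟨a, ha, rfl⟩ := (PMF.mem_support_map_iff _ _ _).1 ((PMF.mem_support_iff _ _).2 hDC)
          have ha' : a ∈ D.image (cycleStructure D) := by simpa using ha
          obtain ⟨τ, hτ, rfl⟩ := Finset.mem_image.1 ha'
          exact ⟨τ, by simp [hτ]⟩
    constructor
    · intro A hA hπA
      obtain ⟨D, hD, hDA⟩ := (PMF.mem_support_bind_iff _ _ _).1 ((PMF.mem_support_iff _ _).2 hA)
      obtain ⟨h1, h2⟩ := eq_nextState_of_step_ne_zero (hne D hD) ((PMF.mem_support_iff _ _).1 hDA) hπA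
      rw [Function.iterate_succ_apply', ← ih1 D hD h1, h2]
    · rw [run, PMF.bind_apply, tsum_eq_single ((nextState c π)^[k] (perms n)), ih2,
        Finset.prod_range_succ, Function.iterate_succ_apply', step_nextState
          (self_mem_iterate hπ k)]
      intro D hD
      rw [mul_eq_zero]
      by_contra! h
      obtain ⟨h1, h2⟩ := h
      have := eq_nextState_of_step_ne_zero (hne D h1) h2 (self_mem_iterate hπ _)
      exact hD (ih1 D h1 this.1)

theorem numChoices_mono (h : C' ⊆ C) (i : Fin n) : numChoices C' i ≤ numChoices C i :=
  Finset.card_le_card (Finset.image_subset_image h)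

theorem unmatched_mono (h : C' ⊆ C) : unmatched C' ⊆ unmatched C := by
  intro i
  simp only [unmatched, Finset.mem_filter, Finset.mem_univ, true_and]
  exact fun h' => h'.trans_le (numChoices_mono h i)

theorem numChoices_le_one {i : Fin n} (h : ∀ π₁ ∈ C, ∀ π₂ ∈ C, π₁.cycleOf i = π₂.cycleOf i) :
    numChoices C i ≤ 1 := by
  refine Finset.card_le_one.2 fun a ha b hb => ?_
  obtain ⟨x, hx, rfl⟩ := Finset.mem_image.1 ha
  obtain ⟨y, hy, rfl⟩ := Finset.mem_image.1 hb
  exact h x hx y hy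

theorem eq_singleton_of_unmatched (h : π ∈ C) (hu : unmatched C = ∅) : C = {π} := by
  refine Finset.eq_singleton_iff_unique_mem.2 ⟨h, fun τ hτ => Equiv.ext fun i => ?_⟩
  have h1 : ¬ 1 < numChoices C i := fun h1 => by
    have : i ∈ unmatched C := by simpa [unmatched] using h1
    simp [hu] at this
  have h2 := Finset.card_le_one.1 (not_lt.1 h1) _ (Finset.mem_image_of_mem _ hτ) _
    (Finset.mem_image_of_mem _ h)
  rw [← Equiv.Perm.cycleOf_apply_self τ i, h2, Equiv.Perm.cycleOf_apply_self]

theorem exists_isGreedyIndex [NeZero n] (C : Finset (Equiv.Perm (Fin n))) :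
    ∃ i, IsGreedyIndex C i := by
  obtain ⟨m, -, hm⟩ := Finset.exists_max_image Finset.univ (numChoices C) ⟨0, Finset.mem_univ _⟩
  let S : Finset (Fin n) := {j | numChoices C j = numChoices C m}
  have hS : S.Nonempty := ⟨m, by simp [S]⟩
  have h1 : numChoices C (S.min' hS) = numChoices C m := by
    simpa [S] using Finset.min'_mem S hS
  refine ⟨S.min' hS, fun j => by rw [h1]; exact hm j (Finset.mem_univ _), fun j hj => ?_⟩
  rw [h1]
  refine lt_of_le_of_ne (hm j (Finset.mem_univ _)) fun he => ?_
  exact absurd (Finset.min'_le S j (by simpa [S] using he)) (not_le.2 hj)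

/-- This gives termination: a regular step settles at least the greedy index, and a final step
settles everything. -/
theorem unmatched_nextState_ssubset (h : π ∈ C) (hu : (unmatched C).Nonempty) :
    unmatched (nextState c π C) ⊂ unmatched C := by
  obtain ⟨j, hj⟩ := hu
  refine (Finset.ssubset_iff_of_subset (unmatched_mono (nextState_subset h))).2 ?_
  by_cases hf : n ≤ 4 ∨ (unmatched C).card ≤ c
  · refine ⟨j, hj, ?_⟩
    rw [nextState, if_pos hf]
    simp [unmatched, numChoices]
  · have : NeZero n := ⟨by omega⟩
    obtain ⟨i, hi⟩ := exists_isGreedyIndex C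
    have hj' : 1 < numChoices C j := by simpa [unmatched] using hj
    have hiu : i ∈ unmatched C := by
      simpa [unmatched] using hj'.trans_le (hi.1 j)
    have hib : i ∈ block C := by
      simp only [block, Finset.mem_filter]
      exact ⟨hiu, i, hi, le_rfl⟩
    refine ⟨i, hiu, ?_⟩
    simp only [unmatched, Finset.mem_filter, Finset.mem_univ, true_and, not_lt]
    refine numChoices_le_one fun π₁ h₁ π₂ h₂ => ?_
    rw [nextState, if_neg hf] at h₁ h₂
    have e := (Finset.mem_filter.1 h₁).2.trans (Finset.mem_filter.1 h₂).2.symm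
    exact congrFun e ⟨i, hib⟩

theorem card_unmatched_iterate (h : π ∈ C) (k : ℕ) :
    (unmatched ((nextState c π)^[k] C)).card ≤ n - k := by
  induction k with
  | zero => simpa using Finset.card_le_univ (unmatched C)
  | succ k ih =>
    rw [Function.iterate_succ_apply']
    rcases (unmatched ((nextState c π)^[k] C)).eq_empty_or_nonempty with h0 | h0
    · have := unmatched_mono (nextState_subset (c := c) (self_mem_iterate h k (c := c)))
      rw [h0, Finset.subset_empty] at this
      simp [this]
    · have := Finset.card_lt_card
        (unmatched_nextState_ssubset (c := c) (self_mem_iterate h k (c := c)) h0)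
      omega

theorem iterate_nextState_eq_singleton (h : π ∈ C) : (nextState c π)^[n] C = {π} := by
  refine eq_singleton_of_unmatched (self_mem_iterate h n) (Finset.card_eq_zero.1 ?_)
  have := card_unmatched_iterate (c := c) h n
  omega

/-- The product of the numbers of options in `k` steps that lead from `C` towards `π`. -/
noncomputable def weight (c k : ℕ) (C : Finset (Equiv.Perm (Fin n))) (π : Equiv.Perm (Fin n)) :
    ℝ :=
  ∏ j ∈ Finset.range k, (numOptions c ((nextState c π)^[j] C) : ℝ)

theorem T_eq_weight (hπ : π ∈ perms n) : T n c π = weight c n (perms n) π := by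
  have h := (run_iterate (c := c) hπ n).2
  rw [iterate_nextState_eq_singleton hπ] at h
  rw [T, P, h, ENNReal.toReal_prod, weight, ← Finset.prod_inv_distrib]
  simp

theorem weight_succ (k : ℕ) : weight c (k + 1) C π =
    numOptions c C * weight c k (nextState c π C) π := by
  simp only [weight]
  rw [Finset.prod_range_succ']
  simp [mul_comm]

theorem weight_pos (h : π ∈ C) (k : ℕ) : 0 < weight c k C π :=
  Finset.prod_pos fun j _ => by exact_mod_cast numOptions_pos (self_mem_iterate h j)

/-- Each option other than that of `π` has a representative outside the class of `π`. In this form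
the bound telescopes along the path. -/
theorem numOptions_add_card_le (π : Equiv.Perm (Fin n)) (C : Finset (Equiv.Perm (Fin n))) :
    numOptions c C + (nextState c π C).card ≤ C.card + 1 := by
  unfold numOptions nextState
  split_ifs
  · simp
  · have h1 : C.image (cycleStructure C) ⊆ insert (cycleStructure C π)
        ({π' ∈ C | ¬ cycleStructure C π' = cycleStructure C π}.image (cycleStructure C)) := by
      intro s hs
      obtain ⟨τ, hτ, rfl⟩ := Finset.mem_image.1 hs
      by_cases he : cycleStructure C τ = cycleStructure C π
      · simp [he]
      · exact Finset.mem_insert_of_mem (Finset.mem_image_of_mem _ (by simp [hτ, he]))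
    have h2 := (Finset.card_le_card h1).trans (Finset.card_insert_le _ _)
    have h3 := Finset.card_image_le
      (s := {π' ∈ C | ¬ cycleStructure C π' = cycleStructure C π}) (f := cycleStructure C)
    have h4 := Finset.card_filter_add_card_filter_not (s := C)
      (fun π' => cycleStructure C π' = cycleStructure C π)
    omega

theorem log_weight_nonneg (h : π ∈ C) (k : ℕ) : 0 ≤ Real.log (weight c k C π) := by
  have h1 : 1 ≤ ∏ j ∈ Finset.range k, numOptions c ((nextState c π)^[j] C) :=
    Nat.one_le_iff_ne_zero.2 (Finset.prod_ne_zero_iff.2 fun j _ => ?_)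
  · refine Real.log_nonneg ?_
    rw [weight]
    exact_mod_cast h1
  · exact (numOptions_pos (self_mem_iterate h j)).ne'

/-- Telescoping via `log x ≤ x - 1`. The bound is crude but uniform in `k`; it is applied only with
at most four indices left. -/
theorem log_weight_le (k : ℕ) : ∀ C : Finset (Equiv.Perm (Fin n)), π ∈ C →
    Real.log (weight c k C π) ≤ C.card := by
  induction k with
  | zero => intro C _; simp [weight]
  | succ k ih =>
    intro C h
    have h1 := self_mem_nextState (c := c) h
    have h0 : (0 : ℝ) < numOptions c C := by exact_mod_cast numOptions_pos h
    rw [weight_succ, Real.log_mul h0.ne' (weight_pos h1 k).ne']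
    have h2 := Real.log_le_sub_one_of_pos h0
    have h3 : (numOptions c C : ℝ) + (nextState c π C).card ≤ C.card + 1 := by
      exact_mod_cast numOptions_add_card_le π C
    linarith [ih _ h1]

end Algorithm

/-! ### Encoding cycles by two displacements. -/

section Cycles

variable {n : ℕ} {π π' π₀ σ : Equiv.Perm (Fin n)} {p q a : ℕ} {j : Fin n}

theorem cycleOf_eq_of_pow (h : ∀ k : ℕ, (π ^ k) j = (π' ^ k) j) : π.cycleOf j = π'.cycleOf j := by
  ext1 y
  rw [Equiv.Perm.cycleOf_apply, Equiv.Perm.cycleOf_apply]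
  by_cases h1 : π.SameCycle j y
  · obtain ⟨k, -, -, rfl⟩ := h1.exists_pow_eq
    have h2 : π'.SameCycle j ((π ^ k) j) := by rw [h k]; exact ⟨k, by simp⟩
    rw [if_pos h1, if_pos h2]
    rw [← Equiv.Perm.mul_apply, ← pow_succ', h, pow_succ', Equiv.Perm.mul_apply, h]
  · have h2 : ¬ π'.SameCycle j y := fun h2 => by
      obtain ⟨k, -, -, rfl⟩ := h2.exists_pow_eq
      exact h1 (by rw [← h k]; exact ⟨k, by simp⟩)
    rw [if_neg h1, if_neg h2]

theorem cycleOf_eq_of_agree (hc : IsCut π q) (hj : (j : ℕ) < q)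
    (e : ∀ i : Fin n, (i : ℕ) < q → π' i = π i) : π.cycleOf j = π'.cycleOf j := by
  refine cycleOf_eq_of_pow fun k => ?_
  suffices ((π ^ k) j : ℕ) < q ∧ (π ^ k) j = (π' ^ k) j from this.2
  induction k with
  | zero => exact ⟨hj, rfl⟩
  | succ k ih =>
    rw [pow_succ', pow_succ', Equiv.Perm.mul_apply, Equiv.Perm.mul_apply]
    exact ⟨hc _ ih.1, by rw [← ih.2, e _ ih.1]⟩

/-- The displacements of the first two points of the orbit of `j`. -/
def key (j : Fin n) (π : Equiv.Perm (Fin n)) : ℤ × ℤ :=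
  ((π j : ℤ) - j, (π (π j) : ℤ) - j)

/-- The key of the `o`-th index of a block of length `l + 1`. -/
def blockKey (o l : ℕ) : ℤ × ℤ :=
  (if o = 0 then l else -1, if o = 0 then (if l = 0 then 0 else l - 1) else
    if o = 1 then l - 1 else -2)

/-- The largest cut `≤ j` starts the block of `j`: if that block ended before `j`, its end would
give a larger cut. -/
theorem exists_block (hπ : π ∈ perms n) (j : Fin n) :
    ∃ A : Fin n, IsCut π A ∧ A ≤ j ∧ j ≤ π A := by
  classical
  have h0 : IsCut π (Nat.findGreatest (IsCut π) j) :=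
    Nat.findGreatest_spec (Nat.zero_le _) (isCut_zero π)
  have hle : Nat.findGreatest (IsCut π) j ≤ j := Nat.findGreatest_le _
  refine ⟨⟨Nat.findGreatest (IsCut π) j, by omega⟩, h0, hle, ?_⟩
  by_contra! hlt
  have h1 := h0.next hπ (i := ⟨Nat.findGreatest (IsCut π) j, by omega⟩) rfl
  have h2 := h0.le_apply (i := ⟨Nat.findGreatest (IsCut π) j, by omega⟩) le_rfl
  have h3 := Nat.le_findGreatest (P := IsCut π) (n := j) (by exact hlt) h1
  omega

theorem key_of_block (hπ : π ∈ perms n) {A : Fin n} {o l : ℕ}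
    (hl : (π A : ℕ) = A + l) (ho : o ≤ l) (hj : (j : ℕ) = A + o) : key j π = blockKey o l := by
  have hl2 : l ≤ 2 := by have := (mem_perms_iff.1 hπ A).2; omega
  have hb : ∀ i : Fin n, (A : ℕ) < i → (i : ℕ) ≤ A + l → (π i : ℕ) + 1 = i := fun i h1 h2 =>
    apply_of_not_isCut hπ (not_isCut_between rfl h1 (by omega))
  have hA : ∀ i : Fin n, (i : ℕ) = A → (π i : ℕ) = A + l := fun i hi => by
    rw [Fin.ext hi, hl]
  have h1 := hb j
  have h2 := hA j
  have h3 := hb (π j)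
  have h4 := hA (π j)
  rw [key, blockKey, Prod.mk.injEq]
  split_ifs <;> omega

theorem exists_key_eq (hπ : π ∈ perms n) (j : Fin n) :
    ∃ o l : ℕ, o ≤ l ∧ l ≤ 2 ∧ key j π = blockKey o l := by
  obtain ⟨A, hc, h1, h2⟩ := exists_block hπ j
  have h3 := (mem_perms_iff.1 hπ A).2
  refine ⟨j - A, π A - A, ?_, ?_, key_of_block (A := A) hπ ?_ ?_ ?_⟩ <;>
  · simp only [Fin.le_def] at *
    omega

/-- The six keys correspond to the six pairs of a block length at most 3 and a position in the
block. -/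
theorem key_mem (hπ : π ∈ perms n) (j : Fin n) :
    key j π ∈ ({(0, 0), (1, 0), (-1, 0), (2, 1), (-1, 1), (-1, -2)} : Finset (ℤ × ℤ)) := by
  obtain ⟨o, l, h1, h2, h3⟩ := exists_key_eq hπ j
  rw [h3]
  interval_cases l <;> interval_cases o <;> decide

/-- Every index has period at most three. -/
theorem exists_period (hπ : π ∈ perms n) (j : Fin n) :
    π j = j ∨ π (π j) = j ∨ π (π (π j)) = j := by
  obtain ⟨A, -, h1, h2⟩ := exists_block hπ j
  have hl2 := (mem_perms_iff.1 hπ A).2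
  have hb : ∀ i : Fin n, (A : ℕ) < i → (i : ℕ) ≤ π A → (π i : ℕ) + 1 = i := fun i h1 h2 =>
    apply_of_not_isCut hπ (not_isCut_between rfl h1 (by omega))
  have hA : ∀ i : Fin n, (i : ℕ) = A → (π i : ℕ) = π A := fun i hi => by rw [Fin.ext hi]
  have b1 := hb j
  have b2 := hb (π j)
  have b3 := hb (π (π j))
  have a1 := hA j
  have a2 := hA (π j)
  have a3 := hA (π (π j))
  simp only [Fin.ext_iff, Fin.le_def] at *
  omega

/-- Periods are at most 3, so two further orbit points determine the cycle. Counting choices thus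
becomes counting pairs of integers. -/
theorem cycleOf_eq_iff_key (hπ : π ∈ perms n) (hπ' : π' ∈ perms n) (j : Fin n) :
    π.cycleOf j = π'.cycleOf j ↔ key j π = key j π' := by
  have hk : key j π = key j π' ↔ π j = π' j ∧ π (π j) = π' (π' j) := by
    simp only [key, Prod.mk.injEq, Fin.ext_iff]
    omega
  rw [hk]
  constructor
  · intro h
    have h1 : ∀ τ : Equiv.Perm (Fin n), τ.cycleOf j (τ j) = τ (τ j) := fun τ =>
      Equiv.Perm.cycleOf_apply_apply_self τ j
    have h2 : π j = π' j := by
      rw [← Equiv.Perm.cycleOf_apply_self π j, h, Equiv.Perm.cycleOf_apply_self]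
    exact ⟨h2, by rw [← h1 π, ← h1 π', h, h2]⟩
  · rintro ⟨h1, h2⟩
    have hs : ∀ (τ : Equiv.Perm (Fin n)) (k d : ℕ), (τ ^ d) j = j →
        (τ ^ (k + d)) j = (τ ^ k) j := fun τ k d h => by
      rw [pow_add, Equiv.Perm.mul_apply, h]
    -- Whether the period is 1, 2 or 3 can be read off from the two points on which `π` and `π'`
    -- agree, so they share it.
    have hd : ∃ d, 1 ≤ d ∧ d ≤ 3 ∧ (π ^ d) j = j ∧ (π' ^ d) j = j := by
      have e1 : ∀ τ : Equiv.Perm (Fin n), (τ ^ 1) j = τ j := fun τ => by simp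
      have e2 : ∀ τ : Equiv.Perm (Fin n), (τ ^ 2) j = τ (τ j) := fun τ => by simp [pow_succ]
      have e3 : ∀ τ : Equiv.Perm (Fin n), (τ ^ 3) j = τ (τ (τ j)) := fun τ => by simp [pow_succ]
      by_cases hj : π j = j
      · exact ⟨1, by omega, by omega, by rw [e1, hj], by rw [e1, ← h1, hj]⟩
      by_cases hj2 : π (π j) = j
      · exact ⟨2, by omega, by omega, by rw [e2, hj2], by rw [e2, ← h2, hj2]⟩
      refine ⟨3, by omega, by omega, ?_, ?_⟩
      · rw [e3]
        exact ((exists_period hπ j).resolve_left hj).resolve_left hj2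
      · rw [e3]
        rw [h1] at hj
        rw [h2] at hj2
        exact ((exists_period hπ' j).resolve_left hj).resolve_left hj2
    obtain ⟨d, hd1, hd3, hd, hd'⟩ := hd
    refine cycleOf_eq_of_pow fun k => ?_
    induction k using Nat.strong_induction_on with
    | _ k ih =>
      rcases lt_or_ge k 3 with hk | hk
      · interval_cases k
        · rfl
        · simpa using h1
        · simpa [pow_succ] using h2
      · obtain ⟨k, rfl⟩ : ∃ k', k = k' + d := ⟨k - d, by omega⟩
        rw [hs _ _ _ hd, hs _ _ _ hd']
        exact ih k (by omega)

theorem card_image_congr {α β γ : Type*} [DecidableEq β] [DecidableEq γ] {s : Finset α}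
    {f : α → β} {g : α → γ} (h : ∀ x ∈ s, ∀ y ∈ s, f x = f y ↔ g x = g y) :
    (s.image f).card = (s.image g).card := by
  have h1 : s.image f = (s.image fun x => (f x, g x)).image Prod.fst := by
    rw [Finset.image_image]; rfl
  have h2 : s.image g = (s.image fun x => (f x, g x)).image Prod.snd := by
    rw [Finset.image_image]; rfl
  rw [h1, h2, Finset.card_image_of_injOn (f := Prod.fst), Finset.card_image_of_injOn (f := Prod.snd)]
  all_goals
    intro a ha b hb hab
    obtain ⟨x, hx, rfl⟩ := Finset.mem_image.1 (Finset.mem_coe.1 ha)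
    obtain ⟨y, hy, rfl⟩ := Finset.mem_image.1 (Finset.mem_coe.1 hb)
    have := h x hx y hy
    simp_all

end Cycles

/-! ### One greedy step: nine options, consuming 3, 4 or 5 indices. -/

section GreedyStep

variable {n c : ℕ} {π π' π₀ σ : Equiv.Perm (Fin n)} {p q a : ℕ} {j : Fin n}

theorem numChoices_eq (C : Finset (Equiv.Perm (Fin n))) (hC : C ⊆ perms n) (j : Fin n) :
    numChoices C j = (C.image (key j)).card :=
  card_image_congr fun _ hx _ hy => cycleOf_eq_iff_key (hC hx) (hC hy) j

theorem cyl_subset (p : ℕ) (π : Equiv.Perm (Fin n)) : cyl p π ⊆ perms n :=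
  fun _ h => (mem_cyl.1 h).1

theorem cyl_subset_of_mem (h : σ ∈ cyl p π) (hpq : p ≤ q) : cyl q σ ⊆ cyl p π := fun τ hτ =>
  mem_cyl.2 ⟨cyl_subset _ _ hτ, fun i hi => by
    rw [(mem_cyl.1 hτ).2 i (by omega), (mem_cyl.1 h).2 i hi]⟩

/-- The key is realised by fixing the indices from `p` to `a - 1` and placing a block of length `l +
1` at `a`. -/
theorem blockKey_mem_image (hπ : π ∈ perms n) (hc : IsCut π p) {o l : ℕ} (hpa : p ≤ a)
    (hl : l ≤ 2) (ho : o ≤ l) (hn : a + l + 1 ≤ n) (hj : (j : ℕ) = a + o) :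
    blockKey o l ∈ (cyl p π).image (key j) := by
  obtain ⟨σ, hσ, h1, h2⟩ := exists_truncate hπ hc
  have hcσ : IsCut σ a := fun i hi => by
    rcases lt_or_ge (i : ℕ) p with h | h
    · have := hc i h
      rw [h1 i h]; omega
    · rw [h2 i h]; exact hi
  have hlen : IsLength n a (l + 1) := ⟨by omega, by omega, by omega⟩
  have hs := child_spec hσ hcσ hlen
  refine Finset.mem_image.2 ⟨child σ a (l + 1),
    cyl_subset_of_mem (mem_cyl.2 ⟨hσ, h1⟩) hpa (child_mem_cyl hσ hcσ hlen), ?_⟩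
  refine key_of_block (A := ⟨a, by omega⟩) hs.1 ?_ ho hj
  have := hs.2.2 ⟨a, by omega⟩ rfl
  simp only
  omega

theorem numChoices_cyl_le_six (p : ℕ) (π : Equiv.Perm (Fin n)) (j : Fin n) :
    numChoices (cyl p π) j ≤ 6 := by
  rw [numChoices_eq _ (cyl_subset p π)]
  refine (Finset.card_le_card (t := {(0, 0), (1, 0), (-1, 0), (2, 1), (-1, 1), (-1, -2)})
    fun x hx => ?_).trans (by decide)
  obtain ⟨τ, hτ, rfl⟩ := Finset.mem_image.1 hx
  exact key_mem (cyl_subset _ _ hτ) j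

/-- Blocks of length at most 3 through `p + 2` lie between `p` and `p + 4`, which is why five
remaining indices are needed. -/
theorem six_le_numChoices_cyl (hπ : π ∈ perms n) (hc : IsCut π p) (hp : p + 5 ≤ n)
    (hj : (j : ℕ) = p + 2) : 6 ≤ numChoices (cyl p π) j := by
  rw [numChoices_eq _ (cyl_subset p π)]
  have h : ({(0, 0), (1, 0), (-1, 0), (2, 1), (-1, 1), (-1, -2)} : Finset (ℤ × ℤ)) ⊆
      (cyl p π).image (key j) := by
    have H : ∀ o l, o ≤ l → l ≤ 2 → blockKey o l ∈ (cyl p π).image (key j) := fun o l h1 h2 =>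
      blockKey_mem_image hπ hc (a := p + 2 - o) (by omega) h2 h1 (by omega) (by omega)
    simp only [Finset.insert_subset_iff, Finset.singleton_subset_iff]
    exact ⟨H 0 0 (by omega) (by omega), H 0 1 (by omega) (by omega), H 1 1 (by omega) (by omega),
      H 0 2 (by omega) (by omega), H 1 2 (by omega) (by omega), H 2 2 (by omega) (by omega)⟩
  exact (by decide : 6 ≤ ({(0, 0), (1, 0), (-1, 0), (2, 1), (-1, 1), (-1, -2)} :
    Finset (ℤ × ℤ)).card).trans (Finset.card_le_card h)

theorem numChoices_cyl_lt (hc : IsCut π p) (hj : (j : ℕ) < p) : numChoices (cyl p π) j ≤ 1 := by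
  have h : ∀ τ ∈ cyl p π, π.cycleOf j = τ.cycleOf j := fun τ hτ =>
    cycleOf_eq_of_agree hc hj (mem_cyl.1 hτ).2
  exact numChoices_le_one fun π₁ h₁ π₂ h₂ => by rw [← h _ h₁, ← h _ h₂]

/-- The key `(-1, -2)`, that of the last index of a 3-block, would reach below the cut `p`. -/
theorem numChoices_cyl_le_five (hc : IsCut π p) (hj : (j : ℕ) < p + 2) :
    numChoices (cyl p π) j ≤ 5 := by
  rcases lt_or_ge (j : ℕ) p with h | h
  · exact (numChoices_cyl_lt hc h).trans (by omega)
  rw [numChoices_eq _ (cyl_subset p π)]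
  refine (Finset.card_le_card (t := {(0, 0), (1, 0), (-1, 0), (2, 1), (-1, 1)})
    fun x hx => ?_).trans (by decide)
  obtain ⟨τ, hτ, rfl⟩ := Finset.mem_image.1 hx
  have h1 := key_mem (cyl_subset _ _ hτ) j
  have h2 := (isCut_of_mem_cyl hc hτ).le_apply ((isCut_of_mem_cyl hc hτ).le_apply h)
  have h3 : key j τ ≠ (-1, -2) := fun h3 => by
    simp only [key, Prod.mk.injEq] at h3
    omega
  simp only [Finset.mem_insert, Finset.mem_singleton] at h1 ⊢
  tauto

theorem isGreedyIndex_cyl_iff (hπ : π ∈ perms n) (hc : IsCut π p) (hp : p + 5 ≤ n) :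
    IsGreedyIndex (cyl p π) j ↔ (j : ℕ) = p + 2 := by
  have h6 := six_le_numChoices_cyl hπ hc hp (j := ⟨p + 2, by omega⟩) rfl
  constructor
  · rintro ⟨h1, h2⟩
    rcases lt_trichotomy (j : ℕ) (p + 2) with h | h | h
    · have := h1 ⟨p + 2, by omega⟩
      have := numChoices_cyl_le_five hc h
      omega
    · exact h
    · have := h2 ⟨p + 2, by omega⟩ h
      have := numChoices_cyl_le_six p π j
      omega
  · intro hj
    have h6 := six_le_numChoices_cyl hπ hc hp hj
    refine ⟨fun i => (numChoices_cyl_le_six p π i).trans h6, fun i hi => ?_⟩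
    have := numChoices_cyl_le_five (j := i) hc (by rw [Fin.lt_def] at hi; omega)
    omega

theorem mem_unmatched_cyl (hπ : π ∈ perms n) (hc : IsCut π p) (hp : p + 2 ≤ n)
    (hj : p ≤ (j : ℕ)) : j ∈ unmatched (cyl p π) := by
  simp only [unmatched, Finset.mem_filter, Finset.mem_univ, true_and]
  rw [numChoices_eq _ (cyl_subset p π), Finset.one_lt_card]
  refine ⟨_, blockKey_mem_image (o := 0) (l := 0) hπ hc hj (by omega) (by omega) (by omega) rfl, ?_⟩
  by_cases h : (j : ℕ) + 1 < n
  · exact ⟨_, blockKey_mem_image (o := 0) (l := 1) hπ hc hj (by omega) (by omega) (by omega) rfl,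
      by decide⟩
  · exact ⟨_, blockKey_mem_image (o := 1) (l := 1) (a := j - 1) hπ hc (by omega) (by omega)
      (by omega) (by omega) (by omega), by decide⟩

theorem mem_block_cyl_iff (hπ : π ∈ perms n) (hc : IsCut π p) (hp : p + 5 ≤ n) :
    j ∈ block (cyl p π) ↔ p ≤ (j : ℕ) ∧ (j : ℕ) ≤ p + 2 := by
  simp only [block, Finset.mem_filter, isGreedyIndex_cyl_iff hπ hc hp]
  constructor
  · rintro ⟨h1, i, hi, hji⟩
    refine ⟨?_, by rw [Fin.le_def] at hji; omega⟩
    by_contra! h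
    have h2 := numChoices_cyl_lt hc h
    have h3 : 1 < numChoices (cyl p π) j := by simpa [unmatched] using h1
    omega
  · rintro ⟨h1, h2⟩
    exact ⟨mem_unmatched_cyl hπ hc (by omega) h1, ⟨p + 2, by omega⟩, rfl, h2⟩

theorem five_le_card_unmatched_cyl (hπ : π ∈ perms n) (hc : IsCut π p) (hp : p + 5 ≤ n) :
    5 ≤ (unmatched (cyl p π)).card := by
  let f : Fin 5 → Fin n := fun k => ⟨p + k, by omega⟩
  have hf : Function.Injective f := fun x y h => by
    simp only [f, Fin.mk.injEq] at h
    exact Fin.ext (by omega)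
  calc 5 = (Finset.univ.image f).card := by rw [Finset.card_image_of_injective _ hf]; simp
    _ ≤ _ := Finset.card_le_card fun x hx => by
      obtain ⟨k, -, rfl⟩ := Finset.mem_image.1 hx
      exact mem_unmatched_cyl hπ hc (by omega) (by simp [f])

/-- The final rule never applies while five indices remain, so the value of `c ≤ 4` affects only the
end of the run. -/
theorem not_final_cyl (hcc : c ≤ 4) (hπ : π ∈ perms n) (hc : IsCut π p) (hp : p + 5 ≤ n) :
    ¬ (n ≤ 4 ∨ (unmatched (cyl p π)).card ≤ c) := by
  have := five_le_card_unmatched_cyl hπ hc hp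
  omega

/-- `cyl q σ` is one of the states that may follow the state `cyl p π₀`. -/
structure IsSuccessor (π₀ : Equiv.Perm (Fin n)) (p q : ℕ) (σ : Equiv.Perm (Fin n)) : Prop where
  mem_cyl : σ ∈ cyl p π₀
  le : p + 3 ≤ q
  isCut : IsCut σ q
  not_isCut : ∀ r, p + 3 ≤ r → r < q → ¬ IsCut σ r

theorem IsSuccessor.of_mem (h : IsSuccessor π₀ p q σ) (hπ : π ∈ cyl q σ) :
    IsSuccessor π₀ p q π where
  mem_cyl := cyl_subset_of_mem h.mem_cyl (by have := h.le; omega) hπ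
  le := h.le
  isCut := isCut_of_mem_cyl h.isCut hπ
  not_isCut r h1 h2 h3 := h.not_isCut r h1 h2 <| h3.congr fun i hi =>
    ((TwoFibonacci.mem_cyl.1 hπ).2 i (by omega)).symm

/-- The cycles of `p, p + 1, p + 2` give the values there, which extend uniquely to the next cut
`q`. Conversely, these cycles lie below `q` and are determined by the values below it. -/
theorem nextState_cyl_self (hcc : c ≤ 4) (hπ₀ : π₀ ∈ perms n) (hc : IsCut π₀ p) (hp : p + 5 ≤ n)
    (h : IsSuccessor π₀ p q π) : nextState c π (cyl p π₀) = cyl q π := by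
  rw [nextState, if_neg (not_final_cyl hcc hπ₀ hc hp)]
  have hπ := mem_cyl.1 h.mem_cyl
  have hle := h.le
  ext τ
  rw [Finset.mem_filter]
  constructor
  · rintro ⟨h1, h2⟩
    have h1' := mem_cyl.1 h1
    refine mem_cyl.2 ⟨h1'.1, eq_of_agree (p := p + 3) hπ.1 h1'.1 (fun i hi => ?_) h.not_isCut⟩
    rcases lt_or_ge (i : ℕ) p with hip | hip
    · rw [h1'.2 i hip, hπ.2 i hip]
    · have hb : i ∈ block (cyl p π₀) := (mem_block_cyl_iff hπ₀ hc hp).2 ⟨hip, by omega⟩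
      have e : τ.cycleOf i = π.cycleOf i := congrFun h2 ⟨i, hb⟩
      rw [← Equiv.Perm.cycleOf_apply_self τ i, e, Equiv.Perm.cycleOf_apply_self]
  · intro hτ
    refine ⟨cyl_subset_of_mem h.mem_cyl (by omega) hτ, funext fun i => ?_⟩
    have hb := (mem_block_cyl_iff hπ₀ hc hp).1 i.2
    exact (cycleOf_eq_of_agree h.isCut (by omega) (mem_cyl.1 hτ).2).symm

theorem nextState_cyl (hcc : c ≤ 4) (hπ₀ : π₀ ∈ perms n) (hc : IsCut π₀ p) (hp : p + 5 ≤ n)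
    (h : IsSuccessor π₀ p q σ) (hπ : π ∈ cyl q σ) : nextState c π (cyl p π₀) = cyl q σ := by
  rw [nextState_cyl_self hcc hπ₀ hc hp (h.of_mem hπ), cyl_eq_of_mem hπ]

theorem isSuccessor_child (hσ : σ ∈ cyl p π₀) (ha : IsCut σ a) {l : ℕ} (hl : IsLength n a l)
    (hpa : p ≤ a) (hap : a ≤ p + 2) (hle : p + 3 ≤ a + l) :
    IsSuccessor π₀ p (a + l) (child σ a l) where
  mem_cyl := cyl_subset_of_mem hσ hpa (child_mem_cyl (cyl_subset _ _ hσ) ha hl)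
  le := hle
  isCut := isCut_child (cyl_subset _ _ hσ) ha hl
  not_isCut r h1 h2 := by
    have han : a < n := by have := hl.1; have := hl.2.2; omega
    refine not_isCut_between (p := a) (i := ⟨a, han⟩) rfl (by omega) ?_
    have := child_apply (cyl_subset _ _ hσ) ha hl (i := ⟨a, han⟩) rfl
    omega

/-- A cylinder with at least five remaining indices splits into nine cylinders. -/
theorem exists_successors (hπ₀ : π₀ ∈ perms n) (hc : IsCut π₀ p) (hp : p + 5 ≤ n) :
    ∃ (σ₃ : Fin 4 → Equiv.Perm (Fin n)) (σ₄ : Fin 3 → Equiv.Perm (Fin n))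
      (σ₅ : Fin 2 → Equiv.Perm (Fin n)),
      (∀ i, IsSuccessor π₀ p (p + 3) (σ₃ i)) ∧ (∀ i, IsSuccessor π₀ p (p + 4) (σ₄ i)) ∧
      (∀ i, IsSuccessor π₀ p (p + 5) (σ₅ i)) ∧
      ∀ g : Equiv.Perm (Fin n) → ℂ, ∑ τ ∈ cyl p π₀, g τ =
        ∑ i, ∑ τ ∈ cyl (p + 3) (σ₃ i), g τ + ∑ i, ∑ τ ∈ cyl (p + 4) (σ₄ i), g τ +
          ∑ i, ∑ τ ∈ cyl (p + 5) (σ₅ i), g τ := by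
  have L : ∀ a l, 1 ≤ l → l ≤ 3 → a ≤ p + 2 → IsLength n a l := fun a l h1 h2 h3 =>
    ⟨h1, h2, by omega⟩
  have l1 := L p 1 (by omega) (by omega) (by omega)
  have l2 := L p 2 (by omega) (by omega) (by omega)
  have l3 := L p 3 (by omega) (by omega) (by omega)
  have l11 := L (p + 1) 1 (by omega) (by omega) (by omega)
  have l12 := L (p + 1) 2 (by omega) (by omega) (by omega)
  have l13 := L (p + 1) 3 (by omega) (by omega) (by omega)
  have l21 := L (p + 2) 1 (by omega) (by omega) (by omega)
  have l22 := L (p + 2) 2 (by omega) (by omega) (by omega)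
  have l23 := L (p + 2) 3 (by omega) (by omega) (by omega)
  have m0 := self_mem_cyl (p := p) hπ₀
  have m1 := child_mem_cyl hπ₀ hc l1
  have m2 := child_mem_cyl hπ₀ hc l2
  have c1 := isCut_child hπ₀ hc l1
  have c2 := isCut_child hπ₀ hc l2
  have p1 := child_mem hπ₀ hc l1
  have p2 := child_mem hπ₀ hc l2
  have m11 := cyl_subset_of_mem m1 (Nat.le_succ p) (child_mem_cyl p1 c1 l11)
  have c11 := isCut_child p1 c1 l11
  have p11 := child_mem p1 c1 l11
  -- Block lengths, stopped once their sum reaches 3: (1,1,1), (1,2), (2,1), (3) with sum 3;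
  -- (1,1,2), (1,3), (2,2) with sum 4; (1,1,3), (2,3) with sum 5.
  refine ⟨![child (child (child π₀ p 1) (p + 1) 1) (p + 2) 1, child (child π₀ p 1) (p + 1) 2,
      child (child π₀ p 2) (p + 2) 1, child π₀ p 3],
    ![child (child (child π₀ p 1) (p + 1) 1) (p + 2) 2, child (child π₀ p 1) (p + 1) 3,
      child (child π₀ p 2) (p + 2) 2],
    ![child (child (child π₀ p 1) (p + 1) 1) (p + 2) 3, child (child π₀ p 2) (p + 2) 3],
    ?_, ?_, ?_, fun g => ?_⟩
  · intro i
    fin_cases i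
    · exact isSuccessor_child m11 c11 l21 (by omega) (by omega) (by omega)
    · exact isSuccessor_child m1 c1 l12 (by omega) (by omega) (by omega)
    · exact isSuccessor_child m2 c2 l21 (by omega) (by omega) (by omega)
    · exact isSuccessor_child m0 hc l3 (by omega) (by omega) (by omega)
  · intro i
    fin_cases i
    · exact isSuccessor_child m11 c11 l22 (by omega) (by omega) (by omega)
    · exact isSuccessor_child m1 c1 l13 (by omega) (by omega) (by omega)
    · exact isSuccessor_child m2 c2 l22 (by omega) (by omega) (by omega)
  · intro i
    fin_cases i
    · exact isSuccessor_child m11 c11 l23 (by omega) (by omega) (by omega)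
    · exact isSuccessor_child m2 c2 l23 (by omega) (by omega) (by omega)
  · rw [sum_cyl_of_three_le hπ₀ hc (by omega), sum_cyl_of_three_le p1 c1 (by omega),
      sum_cyl_of_three_le p2 c2 (by omega), sum_cyl_of_three_le p11 c11 (by omega)]
    simp only [Fin.sum_univ_four, Fin.sum_univ_three, Fin.sum_univ_two, Matrix.cons_val, add_assoc,
      Nat.reduceAdd]
    ring

/-- Writing the number of classes as a sum over elements lets `exists_successors` count options:
each successor cylinder is a full class and contributes 1. -/
theorem card_image_eq_sum_inv {α β : Type*} [DecidableEq β] (s : Finset α) (f : α → β) :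
    ((s.image f).card : ℂ) = ∑ x ∈ s, (({y ∈ s | f y = f x}.card : ℂ))⁻¹ := by
  rw [← Finset.sum_fiberwise_of_maps_to (g := f) (t := s.image f)
    fun x hx => Finset.mem_image_of_mem f hx, Finset.card_eq_sum_ones, Nat.cast_sum]
  refine Finset.sum_congr rfl fun b hb => ?_
  obtain ⟨x, hx, rfl⟩ := Finset.mem_image.1 hb
  have h : ∀ y ∈ ({y ∈ s | f y = f x} : Finset α),
      (({z ∈ s | f z = f y}.card : ℂ))⁻¹ = (({y ∈ s | f y = f x}.card : ℂ))⁻¹ := fun y hy => by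
    rw [(Finset.mem_filter.1 hy).2]
  rw [Finset.sum_congr rfl h, Finset.sum_const, nsmul_eq_mul, Nat.cast_one, mul_inv_cancel₀]
  exact_mod_cast (Finset.card_pos.2 ⟨x, by simp [hx]⟩).ne'

theorem numOptions_cyl (hcc : c ≤ 4) (hπ₀ : π₀ ∈ perms n) (hc : IsCut π₀ p) (hp : p + 5 ≤ n) :
    numOptions c (cyl p π₀) = 9 := by
  have hf := not_final_cyl hcc hπ₀ hc hp
  rw [numOptions, if_neg hf]
  have h0 := card_image_eq_sum_inv (cyl p π₀) (cycleStructure (cyl p π₀))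
  obtain ⟨σ₃, σ₄, σ₅, h3, h4, h5, hs⟩ := exists_successors hπ₀ hc hp
  have key : ∀ q σ, IsSuccessor π₀ p q σ → ∑ x ∈ cyl q σ,
      (({y ∈ cyl p π₀ | cycleStructure (cyl p π₀) y = cycleStructure (cyl p π₀) x}.card : ℂ))⁻¹
      = 1 := fun q σ h => by
    have e : ∀ x ∈ cyl q σ, (({y ∈ cyl p π₀ | cycleStructure (cyl p π₀) y =
        cycleStructure (cyl p π₀) x}.card : ℂ))⁻¹ = ((cyl q σ).card : ℂ)⁻¹ := fun x hx => by
      have := nextState_cyl hcc hπ₀ hc hp h hx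
      rw [nextState, if_neg hf] at this
      rw [this]
    rw [Finset.sum_congr rfl e, Finset.sum_const, nsmul_eq_mul, mul_inv_cancel₀]
    exact_mod_cast (Finset.card_pos.2 ⟨σ, self_mem_cyl (cyl_subset _ _ h.mem_cyl)⟩).ne'
  rw [hs, Finset.sum_congr rfl fun i _ => key _ _ (h3 i),
    Finset.sum_congr rfl fun i _ => key _ _ (h4 i),
    Finset.sum_congr rfl fun i _ => key _ _ (h5 i)] at h0
  simp only [Finset.sum_const, Finset.card_univ, Fintype.card_fin] at h0
  norm_num at h0
  exact_mod_cast h0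

/-- The exponential sum of `log weight` over a cylinder. -/
noncomputable def expSum (c k : ℕ) (t : ℝ) (p : ℕ) (π₀ : Equiv.Perm (Fin n)) : ℂ :=
  ∑ π ∈ cyl p π₀, Complex.exp (Complex.I * t * Real.log (weight c k (cyl p π₀) π))

/-- The first step multiplies every weight by 9, so a common phase factors out of the sum over the
nine successors. -/
theorem exists_expSum_eq (hcc : c ≤ 4) (hπ₀ : π₀ ∈ perms n) (hc : IsCut π₀ p) (hp : p + 5 ≤ n)
    (k : ℕ) (t : ℝ) :
    ∃ (σ₃ : Fin 4 → Equiv.Perm (Fin n)) (σ₄ : Fin 3 → Equiv.Perm (Fin n))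
      (σ₅ : Fin 2 → Equiv.Perm (Fin n)),
      (∀ i, IsSuccessor π₀ p (p + 3) (σ₃ i)) ∧ (∀ i, IsSuccessor π₀ p (p + 4) (σ₄ i)) ∧
      (∀ i, IsSuccessor π₀ p (p + 5) (σ₅ i)) ∧
      expSum c (k + 1) t p π₀ = Complex.exp (Complex.I * t * Real.log 9) *
        (∑ i, expSum c k t (p + 3) (σ₃ i) + ∑ i, expSum c k t (p + 4) (σ₄ i) +
          ∑ i, expSum c k t (p + 5) (σ₅ i)) := by
  obtain ⟨σ₃, σ₄, σ₅, h3, h4, h5, hs⟩ := exists_successors hπ₀ hc hp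
  refine ⟨σ₃, σ₄, σ₅, h3, h4, h5, ?_⟩
  have key : ∀ q σ, IsSuccessor π₀ p q σ →
      ∑ π ∈ cyl q σ, Complex.exp (Complex.I * t * Real.log (weight c (k + 1) (cyl p π₀) π)) =
      Complex.exp (Complex.I * t * Real.log 9) * expSum c k t q σ := fun q σ h => by
    rw [expSum, Finset.mul_sum]
    refine Finset.sum_congr rfl fun π hπ => ?_
    rw [weight_succ, nextState_cyl hcc hπ₀ hc hp h hπ, numOptions_cyl hcc hπ₀ hc hp,
      Real.log_mul (by norm_num) (weight_pos hπ k).ne', ← Complex.exp_add]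
    push_cast
    ring_nf
  rw [expSum, hs, mul_add, mul_add, Finset.mul_sum, Finset.mul_sum, Finset.mul_sum]
  simp only [key _ _ (h3 _), key _ _ (h4 _), key _ _ (h5 _)]

end GreedyStep

/-! ### Scaled counts and error propagation in the recursion. -/

section Recursion

theorem trib_pos : ∀ m, 0 < trib m
  | 0 => by simp [trib]
  | 1 => by simp [trib]
  | 2 => by simp [trib]
  | m + 3 => by have := trib_pos m; simp only [trib]; omega

theorem trib_add_five (m : ℕ) :
    trib (m + 5) = 4 * trib (m + 2) + 3 * trib (m + 1) + 2 * trib m := by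
  simp only [trib]; ring

/-- The number of compositions, scaled by the growth rate. -/
noncomputable def scaled (ψ : ℝ) (m : ℕ) : ℝ := trib m * ψ ^ m

/-- The limit of `scaled ψ`. -/
noncomputable def scaledLim (ψ : ℝ) : ℝ :=
  (scaled ψ 2 + (ψ ^ 2 + ψ ^ 3) * scaled ψ 1 + ψ ^ 3 * scaled ψ 0) / (1 + ψ ^ 2 + 2 * ψ ^ 3)

variable {ψ : ℝ}

theorem scaled_add_five (m : ℕ) : scaled ψ (m + 5) =
    4 * ψ ^ 3 * scaled ψ (m + 2) + 3 * ψ ^ 4 * scaled ψ (m + 1) + 2 * ψ ^ 5 * scaled ψ m := by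
  simp only [scaled, trib_add_five]
  push_cast
  ring

theorem scaled_add_three (m : ℕ) : scaled ψ (m + 3) =
    ψ * scaled ψ (m + 2) + ψ ^ 2 * scaled ψ (m + 1) + ψ ^ 3 * scaled ψ m := by
  simp only [scaled, trib]
  push_cast
  ring

theorem scaled_pos (hψ : 0 < ψ) (m : ℕ) : 0 < scaled ψ m :=
  mul_pos (by exact_mod_cast trib_pos m) (pow_pos hψ m)

theorem lt_one_of_root (hψ : 0 < ψ) (h : ψ + ψ ^ 2 + ψ ^ 3 = 1) : ψ < 1 := by
  have := pow_pos hψ 2; have := pow_pos hψ 3; linarith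

/-- By `scaled_add_three` each term is a weighted mean of the previous three, so the minimum of the
first three persists. -/
theorem exists_le_scaled (hψ : 0 < ψ) (h : ψ + ψ ^ 2 + ψ ^ 3 = 1) :
    ∃ d > 0, ∀ m, d ≤ scaled ψ m := by
  refine ⟨min (scaled ψ 0) (min (scaled ψ 1) (scaled ψ 2)),
    lt_min (scaled_pos hψ 0) (lt_min (scaled_pos hψ 1) (scaled_pos hψ 2)), fun m => ?_⟩
  induction m using Nat.strong_induction_on with
  | _ m ih =>
    match m with
    | 0 => exact min_le_left _ _
    | 1 => exact (min_le_right _ _).trans (min_le_left _ _)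
    | 2 => exact (min_le_right _ _).trans (min_le_right _ _)
    | m + 3 =>
      have h0 := ih m (by omega)
      have h1 := ih (m + 1) (by omega)
      have h2 := ih (m + 2) (by omega)
      rw [scaled_add_three]
      generalize min (scaled ψ 0) (min (scaled ψ 1) (scaled ψ 2)) = d at *
      calc d = ψ * d + ψ ^ 2 * d + ψ ^ 3 * d := by rw [← add_mul, ← add_mul, h, one_mul]
        _ ≤ _ := by gcongr

/-- Removing the characteristic root 1 from the third-order recursion leaves a second-order one. The
invariant `key` of this reduction explains the formula for `scaledLim`. -/
theorem scaled_sub_scaledLim (hψ : 0 < ψ) (h : ψ + ψ ^ 2 + ψ ^ 3 = 1) (m : ℕ) :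
    scaled ψ (m + 2) - scaledLim ψ = -(ψ ^ 2 + ψ ^ 3) * (scaled ψ (m + 1) - scaledLim ψ) -
      ψ ^ 3 * (scaled ψ m - scaledLim ψ) := by
  have hd : (1 + ψ ^ 2 + 2 * ψ ^ 3) ≠ 0 := by positivity
  have key : scaled ψ (m + 2) + (ψ ^ 2 + ψ ^ 3) * scaled ψ (m + 1) + ψ ^ 3 * scaled ψ m =
      (1 + ψ ^ 2 + 2 * ψ ^ 3) * scaledLim ψ := by
    induction m with
    | zero => rw [scaledLim, mul_div_cancel₀ _ hd]
    | succ m ih =>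
      rw [← ih, scaled_add_three]
      linear_combination scaled ψ (m + 2) * h
  linear_combination key

/-- The coefficients of the second-order recursion have absolute sum `ψ² + 2ψ³ = 1 - ψ + ψ³ < 1`;
summing the recursion bounds all partial sums. -/
theorem exists_sum_abs_le (hψ : 0 < ψ) (h : ψ + ψ ^ 2 + ψ ^ 3 = 1) :
    ∃ D, 0 ≤ D ∧ ∀ N, ∑ j ∈ Finset.range N, |scaled ψ j - scaledLim ψ| ≤ D := by
  set e : ℕ → ℝ := fun j => |scaled ψ j - scaledLim ψ| with he
  have he0 : ∀ j, 0 ≤ e j := fun j => abs_nonneg _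
  have h1 := lt_one_of_root hψ h
  have hq : 0 < 1 - (ψ ^ 2 + 2 * ψ ^ 3) := by
    have : ψ ^ 3 < ψ := by
      calc ψ ^ 3 < ψ ^ 1 := pow_lt_pow_right_of_lt_one₀ hψ h1 (by norm_num)
        _ = ψ := pow_one ψ
    linarith
  have hrec : ∀ m, e (m + 2) ≤ (ψ ^ 2 + ψ ^ 3) * e (m + 1) + ψ ^ 3 * e m := fun m => by
    simp only [he]
    rw [scaled_sub_scaledLim hψ h]
    refine (abs_sub _ _).trans (le_of_eq ?_)
    rw [abs_mul, abs_mul, abs_neg, abs_of_pos (by positivity : 0 < ψ ^ 2 + ψ ^ 3),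
      abs_of_pos (by positivity : 0 < ψ ^ 3)]
  have hmono : ∀ N, ∑ j ∈ Finset.range N, e j ≤ ∑ j ∈ Finset.range (N + 1), e j := fun N => by
    rw [Finset.sum_range_succ]; linarith [he0 N]
  have hS : ∀ N, (∑ j ∈ Finset.range (N + 2), e j) * (1 - (ψ ^ 2 + 2 * ψ ^ 3)) ≤ e 0 + e 1 :=
    fun N => by
    have h2 : ∑ j ∈ Finset.range (N + 2), e j = e 0 + e 1 + ∑ j ∈ Finset.range N, e (j + 2) := by
      rw [Finset.sum_range_succ', Finset.sum_range_succ']; ring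
    have h3 : ∑ j ∈ Finset.range N, e (j + 2) ≤ (ψ ^ 2 + ψ ^ 3) * ∑ j ∈ Finset.range N, e (j + 1) +
        ψ ^ 3 * ∑ j ∈ Finset.range N, e j := by
      rw [Finset.mul_sum, Finset.mul_sum, ← Finset.sum_add_distrib]
      exact Finset.sum_le_sum fun j _ => hrec j
    have h4 : ∑ j ∈ Finset.range N, e (j + 1) ≤ ∑ j ∈ Finset.range (N + 2), e j := by
      refine le_trans ?_ (hmono (N + 1))
      rw [Finset.sum_range_succ']; linarith [he0 0]
    have h5 := (hmono N).trans (hmono (N + 1))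
    have h6 := mul_le_mul_of_nonneg_left h4 (by positivity : 0 ≤ ψ ^ 2 + ψ ^ 3)
    have h7 := mul_le_mul_of_nonneg_left h5 (by positivity : 0 ≤ ψ ^ 3)
    nlinarith
  refine ⟨(e 0 + e 1) / (1 - (ψ ^ 2 + 2 * ψ ^ 3)), div_nonneg (add_nonneg (he0 _) (he0 _)) hq.le,
    fun N => ?_⟩
  rw [le_div_iff₀ hq]
  exact (mul_le_mul_of_nonneg_right ((hmono N).trans (hmono (N + 1))) hq.le).trans (hS N)

/-- The phases differ from 1 at first order in `t`, too much to accumulate over `n` steps. Replacing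
the counts `bₗ` by their limit `b` makes the first two orders cancel in `α`; the price `|bₗ - b|` is
summable. -/
theorem norm_step_le {X₃ X₄ X₅ e₃ e₄ e₅ : ℂ} {b₃ b₄ b₅ b B r ζ α : ℝ} (hψ : 0 < ψ)
    (h : 4 * ψ ^ 3 + 3 * ψ ^ 4 + 2 * ψ ^ 5 = 1)
    (h₃ : ‖X₃ - 4 * b₃‖ ≤ 4 * r) (h₄ : ‖X₄ - 3 * b₄‖ ≤ 3 * r) (h₅ : ‖X₅ - 2 * b₅‖ ≤ 2 * r)
    (hB₃ : ‖e₃‖ ≤ B) (hB₄ : ‖e₄‖ ≤ B) (hB₅ : ‖e₅‖ ≤ B)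
    (hζ₃ : ‖e₃ - 1‖ ≤ ζ) (hζ₄ : ‖e₄ - 1‖ ≤ ζ) (hζ₅ : ‖e₅ - 1‖ ≤ ζ)
    (hα : ‖4 * (ψ : ℂ) ^ 3 * e₃ + 3 * ψ ^ 4 * e₄ + 2 * ψ ^ 5 * e₅ - 1‖ ≤ α) :
    ‖ψ ^ 3 * e₃ * X₃ + ψ ^ 4 * e₄ * X₄ + ψ ^ 5 * e₅ * X₅ -
      ((4 * ψ ^ 3 * b₃ + 3 * ψ ^ 4 * b₄ + 2 * ψ ^ 5 * b₅ : ℝ) : ℂ)‖ ≤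
      B * r + ζ * (|b₃ - b| + |b₄ - b| + |b₅ - b|) + |b| * α := by
  have hζ : 0 ≤ ζ := (norm_nonneg _).trans hζ₃
  have hB : 0 ≤ B := (norm_nonneg _).trans hB₃
  have h' : (4 * ψ ^ 3 + 3 * ψ ^ 4 + 2 * ψ ^ 5 : ℂ) = 1 := by exact_mod_cast h
  have p3 : 0 < ψ ^ 3 := by positivity
  have p4 : 0 < ψ ^ 4 := by positivity
  have p5 : 0 < ψ ^ 5 := by positivity
  have e : ψ ^ 3 * e₃ * X₃ + ψ ^ 4 * e₄ * X₄ + ψ ^ 5 * e₅ * X₅ -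
      ((4 * ψ ^ 3 * b₃ + 3 * ψ ^ 4 * b₄ + 2 * ψ ^ 5 * b₅ : ℝ) : ℂ) =
      (((ψ ^ 3 : ℝ) : ℂ) * (e₃ * (X₃ - 4 * b₃)) + ((ψ ^ 4 : ℝ) : ℂ) * (e₄ * (X₄ - 3 * b₄)) +
        ((ψ ^ 5 : ℝ) : ℂ) * (e₅ * (X₅ - 2 * b₅))) +
      (((4 * ψ ^ 3 : ℝ) : ℂ) * ((e₃ - 1) * ((b₃ - b : ℝ) : ℂ)) +
        ((3 * ψ ^ 4 : ℝ) : ℂ) * ((e₄ - 1) * ((b₄ - b : ℝ) : ℂ)) +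
        ((2 * ψ ^ 5 : ℝ) : ℂ) * ((e₅ - 1) * ((b₅ - b : ℝ) : ℂ))) +
      (b : ℂ) * (4 * (ψ : ℂ) ^ 3 * e₃ + 3 * ψ ^ 4 * e₄ + 2 * ψ ^ 5 * e₅ - 1) := by
    push_cast
    linear_combination -(b : ℂ) * h'
  have n1 : ∀ (x : ℝ) (a y : ℂ) (A Y : ℝ), 0 ≤ x → ‖a‖ ≤ A → ‖y‖ ≤ Y →
      ‖(x : ℂ) * (a * y)‖ ≤ x * (A * Y) := fun x a y A Y hx ha hy => by
    rw [norm_mul, norm_mul, Complex.norm_real, Real.norm_of_nonneg hx]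
    have := (norm_nonneg a).trans ha
    gcongr
  have n2 : ∀ x : ℝ, ‖(x : ℂ)‖ ≤ |x| := fun x => by rw [Complex.norm_real, Real.norm_eq_abs]
  rw [e]
  refine (norm_add₃_le).trans (add_le_add_three ?_ ?_ ?_)
  · refine (norm_add₃_le).trans ?_
    refine (add_le_add_three (n1 _ _ _ _ _ p3.le hB₃ h₃) (n1 _ _ _ _ _ p4.le hB₄ h₄)
      (n1 _ _ _ _ _ p5.le hB₅ h₅)).trans (le_of_eq ?_)
    linear_combination B * r * h
  · refine (norm_add₃_le).trans ?_
    refine (add_le_add_three (n1 _ _ _ _ _ (by positivity) hζ₃ (n2 _))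
      (n1 _ _ _ _ _ (by positivity) hζ₄ (n2 _))
      (n1 _ _ _ _ _ (by positivity) hζ₅ (n2 _))).trans ?_
    have q : ∀ x y : ℝ, x ≤ 1 → 0 ≤ y → x * (ζ * y) ≤ ζ * y := fun x y hx hy =>
      mul_le_of_le_one_left (mul_nonneg hζ hy) hx
    have := q (4 * ψ ^ 3) |b₃ - b| (by linarith) (abs_nonneg _)
    have := q (3 * ψ ^ 4) |b₄ - b| (by linarith) (abs_nonneg _)
    have := q (2 * ψ ^ 5) |b₅ - b| (by linarith) (abs_nonneg _)
    linarith
  · rw [norm_mul, Complex.norm_real, Real.norm_eq_abs]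
    gcongr

theorem norm_sum_sub_le {ι : Type*} [Fintype ι] (x : ι → ℂ) (b : ℂ) {r : ℝ}
    (h : ∀ i, ‖x i - b‖ ≤ r) : ‖∑ i, x i - Fintype.card ι * b‖ ≤ Fintype.card ι * r := by
  have : ∑ i, x i - Fintype.card ι * b = ∑ i, (x i - b) := by
    rw [Finset.sum_sub_distrib]; simp
  rw [this]
  refine (norm_sum_le_of_le _ fun i _ => h i).trans (le_of_eq ?_)
  simp

/-- If the scaled exponential sums of small cylinders are close to the scaled cardinalities, then
so are all of them, up to the accumulated error of the recursion. -/
theorem norm_expSum_sub_le {n c : ℕ} (hcc : c ≤ 4) (hψ : 0 < ψ)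
    (h : 4 * ψ ^ 3 + 3 * ψ ^ 4 + 2 * ψ ^ 5 = 1) {t B ζ α b : ℝ} {s : ℂ} {R : ℕ → ℝ} (hB1 : 1 ≤ B)
    (hB : ∀ l : ℕ, 3 ≤ l → l ≤ 5 → ‖Complex.exp (Complex.I * t * Real.log 9 - l * s)‖ ≤ B)
    (hζ : ∀ l : ℕ, 3 ≤ l → l ≤ 5 → ‖Complex.exp (Complex.I * t * Real.log 9 - l * s) - 1‖ ≤ ζ)
    (hα : ‖4 * (ψ : ℂ) ^ 3 * Complex.exp (Complex.I * t * Real.log 9 - (3 : ℕ) * s) +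
      3 * ψ ^ 4 * Complex.exp (Complex.I * t * Real.log 9 - (4 : ℕ) * s) +
      2 * ψ ^ 5 * Complex.exp (Complex.I * t * Real.log 9 - (5 : ℕ) * s) - 1‖ ≤ α)
    (hR : Monotone R) (hR0 : 0 ≤ R 0)
    (hRs : ∀ m, R (m + 4) + ζ * (|scaled ψ (m + 2) - b| + |scaled ψ (m + 1) - b| +
      |scaled ψ m - b|) + |b| * α ≤ R (m + 5))
    (hbase : ∀ m ≤ 4, ∀ k p, ∀ π₀ ∈ perms n, IsCut π₀ p → p + m = n →
      ‖expSum c k t p π₀ * (ψ * Complex.exp (-s)) ^ m - scaled ψ m‖ ≤ R m)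
    (m : ℕ) : ∀ k p, m ≤ k → ∀ π₀ ∈ perms n, IsCut π₀ p → p + m = n →
      ‖expSum c k t p π₀ * (ψ * Complex.exp (-s)) ^ m - scaled ψ m‖ ≤ B ^ m * R m := by
  have hRnn : ∀ m, 0 ≤ R m := fun m => hR0.trans (hR (Nat.zero_le m))
  induction m using Nat.strong_induction_on with
  | _ m ih =>
    intro k p hk π₀ hπ₀ hc hm
    rcases lt_or_ge m 5 with h5 | h5
    · refine (hbase m (by omega) k p π₀ hπ₀ hc hm).trans ?_
      exact le_mul_of_one_le_left (hRnn m) (one_le_pow₀ hB1)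
    obtain ⟨m, rfl⟩ : ∃ m', m = m' + 5 := ⟨m - 5, by omega⟩
    obtain ⟨k, rfl⟩ : ∃ k', k = k' + 1 := ⟨k - 1, by omega⟩
    obtain ⟨σ₃, σ₄, σ₅, s3, s4, s5, e⟩ := exists_expSum_eq hcc hπ₀ hc (by omega) k t
    set u : ℂ := ψ * Complex.exp (-s) with hu
    set r : ℝ := B ^ (m + 4) * R (m + 4) with hr
    have key : ∀ q m', m' ≤ m + 2 → q + m' = n → ∀ σ, IsSuccessor π₀ p q σ →
        ‖expSum c k t q σ * u ^ m' - scaled ψ m'‖ ≤ r := fun q m' hm' hq σ hσ => by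
      refine (ih m' (by omega) k q (by omega) σ (cyl_subset _ _ hσ.mem_cyl) hσ.isCut hq).trans ?_
      refine mul_le_mul (pow_le_pow_right₀ hB1 (by omega)) (hR (by omega)) (hRnn _) (by positivity)
    have k3 := norm_sum_sub_le _ _ fun i => key (p + 3) (m + 2) (by omega) (by omega) _ (s3 i)
    have k4 := norm_sum_sub_le _ _ fun i => key (p + 4) (m + 1) (by omega) (by omega) _ (s4 i)
    have k5 := norm_sum_sub_le _ _ fun i => key (p + 5) m (by omega) (by omega) _ (s5 i)
    simp only [Fintype.card_fin, Nat.cast_ofNat] at k3 k4 k5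
    have hpow : ∀ l : ℕ, Complex.exp (Complex.I * t * Real.log 9) * u ^ l =
        ψ ^ l * Complex.exp (Complex.I * t * Real.log 9 - l * s) := fun l => by
      rw [hu, mul_pow, ← Complex.exp_nat_mul, mul_left_comm, ← Complex.exp_add]
      ring_nf
    have main := norm_step_le (b := b) hψ h k3 k4 k5
      (hB 3 (by omega) (by omega)) (hB 4 (by omega) (by omega)) (hB 5 (by omega) (by omega))
      (hζ 3 (by omega) (by omega)) (hζ 4 (by omega) (by omega)) (hζ 5 (by omega) (by omega)) hα
    rw [e, scaled_add_five]
    have e2 : Complex.exp (Complex.I * t * Real.log 9) *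
        (∑ i, expSum c k t (p + 3) (σ₃ i) + ∑ i, expSum c k t (p + 4) (σ₄ i) +
          ∑ i, expSum c k t (p + 5) (σ₅ i)) * u ^ (m + 5) =
        ψ ^ 3 * Complex.exp (Complex.I * t * Real.log 9 - (3 : ℕ) * s) *
          ∑ i, expSum c k t (p + 3) (σ₃ i) * u ^ (m + 2) +
        ψ ^ 4 * Complex.exp (Complex.I * t * Real.log 9 - (4 : ℕ) * s) *
          ∑ i, expSum c k t (p + 4) (σ₄ i) * u ^ (m + 1) +
        ψ ^ 5 * Complex.exp (Complex.I * t * Real.log 9 - (5 : ℕ) * s) *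
          ∑ i, expSum c k t (p + 5) (σ₅ i) * u ^ m := by
      rw [← hpow, ← hpow, ← hpow, ← Finset.sum_mul, ← Finset.sum_mul, ← Finset.sum_mul]
      ring
    rw [e2]
    refine main.trans ?_
    have hRs' := hRs m
    set err := ζ * (|scaled ψ (m + 2) - b| + |scaled ψ (m + 1) - b| + |scaled ψ m - b|) + |b| * α
      with herr
    have hζ0 : 0 ≤ ζ := (norm_nonneg _).trans (hζ 3 (by omega) (by omega))
    have hα0 : 0 ≤ α := (norm_nonneg _).trans hα
    have herr0 : 0 ≤ err := by positivity
    calc B * r + ζ * (|scaled ψ (m + 2) - b| + |scaled ψ (m + 1) - b| + |scaled ψ m - b|) + |b| * α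
        = B ^ (m + 5) * R (m + 4) + 1 * err := by rw [herr, hr]; ring
      _ ≤ B ^ (m + 5) * R (m + 4) + B ^ (m + 5) * err := by
        gcongr; exact one_le_pow₀ hB1
      _ = B ^ (m + 5) * (R (m + 4) + err) := by ring
      _ ≤ B ^ (m + 5) * R (m + 5) := by
        gcongr; rw [herr]; linarith

theorem trib_le_seven {m : ℕ} (hm : m ≤ 4) : trib m ≤ 7 := by
  interval_cases m <;> simp [trib]

/-- With at most four indices left there are at most 7 permutations, each with log weight at most 7;
hence `49 = 7 * 7`. -/
theorem norm_expSum_base_le {n c : ℕ} (hψ : 0 < ψ) (hψ1 : ψ ≤ 1) {t η : ℝ} {s : ℂ} {m k p : ℕ}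
    (hm : m ≤ 4) (hη : ‖Complex.exp (-(m * s)) - 1‖ ≤ η) {π₀ : Equiv.Perm (Fin n)}
    (hπ₀ : π₀ ∈ perms n) (hc : IsCut π₀ p) (hpm : p + m = n) :
    ‖expSum c k t p π₀ * (ψ * Complex.exp (-s)) ^ m - scaled ψ m‖ ≤ 7 * η + 49 * |t| := by
  have hcard := card_cyl m p π₀ hπ₀ hc hpm
  have h7 : (trib m : ℝ) ≤ 7 := by exact_mod_cast trib_le_seven hm
  have h1 : ‖expSum c k t p π₀‖ ≤ trib m := by
    rw [expSum, ← hcard]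
    refine (norm_sum_le_of_le (cyl p π₀) (f := fun π => Complex.exp (Complex.I * t *
      Real.log (weight c k (cyl p π₀) π))) (n := fun _ => 1) fun π _ => le_of_eq ?_).trans (by simp)
    rw [show Complex.I * t * Real.log (weight c k (cyl p π₀) π) =
      ((t * Real.log (weight c k (cyl p π₀) π) : ℝ) : ℂ) * Complex.I by push_cast; ring]
    exact Complex.norm_exp_ofReal_mul_I _
  have h2 : ‖expSum c k t p π₀ - trib m‖ ≤ 49 * |t| := by
    have : expSum c k t p π₀ - trib m = ∑ π ∈ cyl p π₀,
        (Complex.exp (Complex.I * (t * Real.log (weight c k (cyl p π₀) π) : ℝ)) - 1) := by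
      rw [Finset.sum_sub_distrib, Finset.sum_const, hcard, expSum]
      push_cast
      simp only [mul_assoc, nsmul_eq_mul, mul_one]
    rw [this]
    refine (norm_sum_le_of_le (cyl p π₀) (n := fun _ => |t| * 7) fun π hπ => ?_).trans ?_
    · refine (Real.norm_exp_I_mul_ofReal_sub_one_le).trans ?_
      rw [norm_mul, Real.norm_eq_abs, Real.norm_of_nonneg (log_weight_nonneg hπ k)]
      gcongr
      refine (log_weight_le k _ hπ).trans ?_
      rwa [hcard]
    · rw [Finset.sum_const, hcard, nsmul_eq_mul]
      nlinarith [abs_nonneg t]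
  have e : expSum c k t p π₀ * (ψ * Complex.exp (-s)) ^ m - scaled ψ m =
      ((ψ ^ m : ℝ) : ℂ) * (expSum c k t p π₀ * (Complex.exp (-(m * s)) - 1) +
        (expSum c k t p π₀ - trib m)) := by
    rw [mul_pow, ← Complex.exp_nat_mul, scaled, mul_neg]
    push_cast
    ring
  have hη0 := (norm_nonneg _).trans hη
  rw [e, norm_mul, Complex.norm_real, Real.norm_of_nonneg (by positivity)]
  calc ψ ^ m * _ ≤ 1 * (‖expSum c k t p π₀ * (Complex.exp (-(m * s)) - 1)‖ +
        ‖expSum c k t p π₀ - trib m‖) := by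
        gcongr
        · exact pow_le_one₀ hψ.le hψ1
        · exact norm_add_le _ _
    _ ≤ 7 * η + 49 * |t| := by
      rw [one_mul, norm_mul]
      gcongr
      exact h1.trans h7

end Recursion

/-! ### Second-order solution of the characteristic equation. -/

section Expansion

open Asymptotics

/-- The second-order expansion of the solution `s` of `∑ pₗ exp (w - l s) = 1` near `w = 0`. -/
noncomputable def root (M V : ℝ) (w : ℂ) : ℂ := w / M + V / (2 * M ^ 3) * w ^ 2

theorem continuous_root (M V : ℝ) : Continuous (root M V) := by
  unfold root; fun_prop

theorem root_zero (M V : ℝ) : root M V 0 = 0 := by simp [root]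

theorem root_isBigO (M V : ℝ) : root M V =O[𝓝 0] (fun w : ℂ => w) := by
  have e : root M V = fun w : ℂ => w * (1 / M + V / (2 * M ^ 3) * w) := by
    ext w; rw [root]; ring
  have h : (fun w : ℂ => (1 / M + V / (2 * M ^ 3) * w : ℂ)) =O[𝓝 0] (fun _ => (1 : ℂ)) :=
    (Continuous.tendsto (by fun_prop) 0).isBigO_one ℂ
  rw [e]
  simpa using (isBigO_refl (fun w : ℂ => w) (𝓝 0)).mul h

/-- The exponents have mean `w - M s` and second moment `(w - M s)² + V s²`. The quadratic term of
`s` makes `w - M s = -V w² / (2 M²)`, which cancels the leading part of `V s² / 2`. -/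
theorem expansion_isBigO {p₃ p₄ p₅ M V : ℝ} (hp : p₃ + p₄ + p₅ = 1)
    (hM : M = 3 * p₃ + 4 * p₄ + 5 * p₅)
    (hV : V = 3 ^ 2 * p₃ + 4 ^ 2 * p₄ + 5 ^ 2 * p₅ - M ^ 2) (hM0 : M ≠ 0) :
    (fun w : ℂ => p₃ * Complex.exp (w - (3 : ℕ) * root M V w) +
      p₄ * Complex.exp (w - (4 : ℕ) * root M V w) +
      p₅ * Complex.exp (w - (5 : ℕ) * root M V w) - 1) =O[𝓝 0] (fun w => w ^ 3) := by
  have hz : ∀ l : ℕ, (fun w : ℂ => w - l * root M V w) =O[𝓝 0] (fun w : ℂ => w) := fun l =>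
    (isBigO_refl _ _).sub ((root_isBigO M V).const_mul_left _)
  have hz0 : ∀ l : ℕ, Tendsto (fun w : ℂ => w - l * root M V w) (𝓝 0) (𝓝 0) := fun l => by
    have hc : Continuous fun w : ℂ => w - l * root M V w := by
      have := continuous_root M V
      fun_prop
    simpa [root_zero] using hc.tendsto 0
  have hexp : ∀ l : ℕ, (fun w : ℂ => Complex.exp (w - l * root M V w) -
      (1 + (w - l * root M V w) + (w - l * root M V w) ^ 2 / 2)) =O[𝓝 0] (fun w => w ^ 3) :=
    fun l => by
    have h := ((Complex.exp_sub_sum_range_isBigO_pow 3).comp_tendsto (hz0 l)).trans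
      ((hz l).pow 3)
    refine h.congr_left fun w => ?_
    simp [Finset.sum_range_succ]
  set a : ℂ := 1 / M with ha_def
  have ha : a * M = 1 := by
    rw [ha_def, one_div, inv_mul_cancel₀]
    exact_mod_cast hM0
  have hs : ∀ w, root M V w = a * w + V * a ^ 3 / 2 * w ^ 2 := fun w => by
    rw [root, ha_def]; ring
  have hpC : (p₃ + p₄ + p₅ : ℂ) = 1 := by exact_mod_cast hp
  have hMC : (M : ℂ) = 3 * p₃ + 4 * p₄ + 5 * p₅ := by exact_mod_cast hM
  have hVC : (V : ℂ) = 3 ^ 2 * p₃ + 4 ^ 2 * p₄ + 5 ^ 2 * p₅ - M ^ 2 := by exact_mod_cast hV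
  -- What the second-order Taylor terms leave after this cancellation: only powers `w³` and `w⁴`.
  have hrest : (fun w : ℂ => w ^ 3 * (V * (V * a ^ 3 / 2) * a +
      w * ((V * a ^ 2 / 2) ^ 2 / 2 + V * (V * a ^ 3 / 2) ^ 2 / 2))) =O[𝓝 0]
      (fun w => w ^ 3) := by
    have h : (fun w : ℂ => V * (V * a ^ 3 / 2) * a +
      w * ((V * a ^ 2 / 2) ^ 2 / 2 + V * (V * a ^ 3 / 2) ^ 2 / 2)) =O[𝓝 0] (fun _ => (1 : ℂ)) :=
      (Continuous.tendsto (by fun_prop) 0).isBigO_one ℂ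
    simpa using (isBigO_refl (fun w : ℂ => w ^ 3) (𝓝 0)).mul h
  refine (((((hexp 3).const_mul_left (p₃ : ℂ)).add ((hexp 4).const_mul_left (p₄ : ℂ))).add
    ((hexp 5).const_mul_left (p₅ : ℂ))).add hrest).congr_left fun w => ?_
  set s := root M V w with hs_def
  have hs' : s = a * w + V * a ^ 3 / 2 * w ^ 2 := hs w
  have e1 : p₃ * (w - (3 : ℕ) * s) + p₄ * (w - (4 : ℕ) * s) + p₅ * (w - (5 : ℕ) * s) =
      w - M * s := by
    push_cast
    linear_combination w * hpC + s * hMC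
  have e2 : p₃ * (w - (3 : ℕ) * s) ^ 2 + p₄ * (w - (4 : ℕ) * s) ^ 2 +
      p₅ * (w - (5 : ℕ) * s) ^ 2 = (w - M * s) ^ 2 + V * s ^ 2 := by
    push_cast
    linear_combination w ^ 2 * hpC + 2 * w * s * hMC - s ^ 2 * hVC
  have e3 : w - M * s = -(V * a ^ 2 / 2 * w ^ 2) := by
    rw [hs']
    linear_combination (-w - V * a ^ 2 / 2 * w ^ 2) * ha
  have e4 : V * s ^ 2 = V * (a * w + V * a ^ 3 / 2 * w ^ 2) ^ 2 := by rw [hs']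
  rw [e3] at e1 e2
  rw [e4] at e2
  linear_combination -e1 - e2 / 2 - hpC

end Expansion

/-! ### Numerical values of the constants. -/

section Numerics

theorem exists_root : ∃ ψ : ℝ, 0.5436890 ≤ ψ ∧ ψ ≤ 0.5436891 ∧ ψ + ψ ^ 2 + ψ ^ 3 = 1 := by
  have hc : ContinuousOn (fun x : ℝ => x + x ^ 2 + x ^ 3) (Set.Icc 0.5436890 0.5436891) := by
    fun_prop
  obtain ⟨x, hx, h⟩ := intermediate_value_Icc (by norm_num) hc
    (show (1 : ℝ) ∈ Set.Icc _ _ from ⟨by norm_num, by norm_num⟩)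
  exact ⟨x, hx.1, hx.2, h⟩

theorem mean_variance_bounds {ψ m v : ℝ} (h1 : 0.5436890 ≤ ψ) (h2 : ψ ≤ 0.5436891)
    (hm : m = 3 * (4 * ψ ^ 3) + 4 * (3 * ψ ^ 4) + 5 * (2 * ψ ^ 5))
    (hv : v = 3 ^ 2 * (4 * ψ ^ 3) + 4 ^ 2 * (3 * ψ ^ 4) + 5 ^ 2 * (2 * ψ ^ 5) - m ^ 2) :
    (3.452158 ≤ m ∧ m ≤ 3.452163) ∧ 0.43771 ≤ v ∧ v ≤ 0.43777 := by
  have h0 : 0 ≤ ψ := by linarith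
  have l : ∀ k : ℕ, (0.5436890 : ℝ) ^ k ≤ ψ ^ k := fun k => by gcongr
  have u : ∀ k : ℕ, ψ ^ k ≤ (0.5436891 : ℝ) ^ k := fun k => by gcongr
  have l3 := l 3
  have l4 := l 4
  have l5 := l 5
  have u3 := u 3
  have u4 := u 4
  have u5 := u 5
  norm_num at l3 l4 l5 u3 u4 u5
  have b1 : 3.452159 ≤ m := by rw [hm]; linarith
  have b2 : m ≤ 3.452163 := by rw [hm]; linarith
  have q1 : 3.452159 ^ 2 ≤ m ^ 2 := by gcongr
  have q2 : m ^ 2 ≤ 3.452163 ^ 2 := by gcongr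
  norm_num at q1 q2
  refine ⟨⟨by linarith, b2⟩, ?_, ?_⟩
  · rw [hv]; linarith
  · rw [hv]; linarith

theorem numerical_bounds {m v : ℝ} (hm1 : 3.452158 ≤ m) (hm2 : m ≤ 3.452163)
    (hv1 : 0.43771 ≤ v) (hv2 : v ≤ 0.43777) :
    |Real.log 9 / m - 0.6365| ≤ 0.00005 ∧ |Real.log 9 ^ 2 * (v / m ^ 3) - 0.0514| ≤ 0.00005 := by
  have hl : Real.log 9 = 2 * Real.log 3 := by
    rw [show (9 : ℝ) = 3 ^ 2 by norm_num, Real.log_pow]; norm_num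
  have l1 : 2.19722457 ≤ Real.log 9 := by rw [hl]; linarith [Real.log_three_gt_d9]
  have l2 : Real.log 9 ≤ 2.19722458 := by rw [hl]; linarith [Real.log_three_lt_d9]
  have hm0 : 0 < m := by linarith
  have q1 : (2.19722457 : ℝ) ^ 2 ≤ Real.log 9 ^ 2 := by gcongr
  have q2 : Real.log 9 ^ 2 ≤ (2.19722458 : ℝ) ^ 2 := by gcongr
  have c1 : (3.452158 : ℝ) ^ 3 ≤ m ^ 3 := by gcongr
  have c2 : m ^ 3 ≤ (3.452163 : ℝ) ^ 3 := by gcongr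
  have r1 : (2.19722457 : ℝ) ^ 2 * 0.43771 ≤ Real.log 9 ^ 2 * v := by gcongr
  have r2 : Real.log 9 ^ 2 * v ≤ (2.19722458 : ℝ) ^ 2 * 0.43777 := by gcongr
  constructor
  · rw [abs_le]
    constructor
    · rw [le_sub_iff_add_le, le_div_iff₀ hm0]; linarith
    · rw [sub_le_iff_le_add, div_le_iff₀ hm0]; linarith
  · have h3 : 0 < m ^ 3 := by positivity
    rw [← mul_div_assoc, abs_le]
    norm_num at c1 c2 r1 r2
    constructor
    · rw [le_sub_iff_add_le, le_div_iff₀ h3]; linarith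
    · rw [sub_le_iff_le_add, div_le_iff₀ h3]; linarith

end Numerics

/-! ### Convergence of the normalised exponential sums. -/

section Limit

/-- Truncated subtraction repeats `f 0` for the first `k` indices, which costs the extra `k * D`. -/
theorem sum_shift_le {f : ℕ → ℝ} {D : ℝ} (hf : ∀ j, 0 ≤ f j)
    (hD : ∀ N, ∑ j ∈ Finset.range N, f j ≤ D) (k N : ℕ) :
    ∑ j ∈ Finset.range N, f (j - k) ≤ (k + 1) * D := by
  have h0 : f 0 ≤ D := by simpa using hD 1
  calc ∑ j ∈ Finset.range N, f (j - k) ≤ ∑ j ∈ Finset.range (k + N), f (j - k) :=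
        Finset.sum_le_sum_of_subset_of_nonneg (Finset.range_mono (by omega)) fun _ _ _ => hf _
    _ = ∑ j ∈ Finset.range k, f 0 + ∑ j ∈ Finset.range N, f j := by
        rw [Finset.sum_range_add]
        congr 1
        · refine Finset.sum_congr rfl fun j hj => ?_
          rw [Nat.sub_eq_zero_of_le (Finset.mem_range.1 hj).le]
        · simp
    _ ≤ k * D + D := by
        gcongr
        · simp only [Finset.sum_const, Finset.card_range, nsmul_eq_mul]
          gcongr
        · exact hD N
    _ = _ := by ring

variable {ψ M V σ μ : ℝ}

/-- The bound on the exponential sum of the whole of `perms n` for `t = θ / (σ √n)`,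
in terms of `w = i t log 9`. -/
theorem norm_expSum_perms_sub_le {c : ℕ} (hcc : c ≤ 4) (hψ : 0 < ψ)
    (hroot : ψ + ψ ^ 2 + ψ ^ 3 = 1) (h : 4 * ψ ^ 3 + 3 * ψ ^ 4 + 2 * ψ ^ 5 = 1)
    (hVM : 0 ≤ V / (2 * M ^ 3)) {D : ℝ}
    (hD : ∀ N, ∑ j ∈ Finset.range N, |scaled ψ j - scaledLim ψ| ≤ D) (n : ℕ) (t : ℝ) {w : ℂ}
    (hw : w = Complex.I * t * Real.log 9) :
    ‖expSum c n t 0 (1 : Equiv.Perm (Fin n)) * (ψ * Complex.exp (-root M V w)) ^ n -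
      scaled ψ n‖ ≤ Real.exp (5 * (V / (2 * M ^ 3)) * (t * Real.log 9) ^ 2) ^ n *
      (7 * ∑ m ∈ Finset.range 5, ‖Complex.exp (-(m * root M V w)) - 1‖ + 49 * |t| +
        n * (|scaledLim ψ| * ‖4 * (ψ : ℂ) ^ 3 * Complex.exp (w - (3 : ℕ) * root M V w) +
          3 * ψ ^ 4 * Complex.exp (w - (4 : ℕ) * root M V w) +
          2 * ψ ^ 5 * Complex.exp (w - (5 : ℕ) * root M V w) - 1‖) +
        (∑ l ∈ Finset.range 6, ‖Complex.exp (w - l * root M V w) - 1‖) * (12 * D)) := by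
  set s := root M V w with hs
  set η := ∑ m ∈ Finset.range 5, ‖Complex.exp (-(m * s)) - 1‖ with hη
  set ζ := ∑ l ∈ Finset.range 6, ‖Complex.exp (w - l * s) - 1‖ with hζ
  set α := ‖4 * (ψ : ℂ) ^ 3 * Complex.exp (w - (3 : ℕ) * s) +
    3 * ψ ^ 4 * Complex.exp (w - (4 : ℕ) * s) +
    2 * ψ ^ 5 * Complex.exp (w - (5 : ℕ) * s) - 1‖ with hα
  set b := scaledLim ψ with hb
  set y := t * Real.log 9 with hy
  have hwy : w = (y : ℂ) * Complex.I := by rw [hw, hy]; push_cast; ring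
  have hη0 : 0 ≤ η := Finset.sum_nonneg fun _ _ => norm_nonneg _
  have hζ0 : 0 ≤ ζ := Finset.sum_nonneg fun _ _ => norm_nonneg _
  have hα0 : 0 ≤ α := norm_nonneg _
  let δ : ℕ → ℝ := fun j => |scaled ψ j - b|
  have hδ0 : ∀ j, 0 ≤ δ j := fun j => abs_nonneg _
  -- The shifts 2, 3, 4 turn the summand at `j = m + 4` into the errors at `m + 2`, `m + 1`, `m` of
  -- the step to `m + 5`.
  let R : ℕ → ℝ := fun m => 7 * η + 49 * |t| + m * (|b| * α) +
    ζ * ∑ j ∈ Finset.range m, (δ (j - 2) + δ (j - 3) + δ (j - 4))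
  have hRmono : Monotone R := monotone_nat_of_le_succ fun m => by
    simp only [R, Finset.sum_range_succ]
    push_cast
    have h1 : 0 ≤ |b| * α := by positivity
    have h2 : 0 ≤ ζ * (δ (m - 2) + δ (m - 3) + δ (m - 4)) :=
      mul_nonneg hζ0 (add_nonneg (add_nonneg (hδ0 _) (hδ0 _)) (hδ0 _))
    linarith
  have hre : ∀ l : ℕ, l ≤ 5 →
      ‖Complex.exp (w - l * s)‖ ≤ Real.exp (5 * (V / (2 * M ^ 3)) * y ^ 2) := fun l hl => by
    -- As `w` is purely imaginary, only the quadratic term of `s` contributes to the real part.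
    have e : w - l * s = ((l * (V / (2 * M ^ 3)) * y ^ 2 : ℝ) : ℂ) +
        ((y - l * (y / M) : ℝ) : ℂ) * Complex.I := by
      rw [hs, root, hwy, mul_pow, Complex.I_sq]
      push_cast
      ring
    rw [e, Complex.norm_exp, Complex.add_re, Complex.ofReal_re, Complex.re_ofReal_mul,
      Complex.I_re, mul_zero, add_zero]
    refine Real.exp_le_exp.2 ?_
    have : (l : ℝ) ≤ 5 := by exact_mod_cast hl
    gcongr
  have main := norm_expSum_sub_le (n := n) (c := c) hcc hψ h (t := t)
    (B := Real.exp (5 * (V / (2 * M ^ 3)) * y ^ 2)) (ζ := ζ) (α := α) (b := b) (s := s) (R := R)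
    (Real.one_le_exp (by positivity))
    (fun l _ hl => by rw [← hw]; exact hre l hl)
    (fun l _ hl => by
      rw [← hw]
      exact Finset.single_le_sum (f := fun l : ℕ => ‖Complex.exp (w - l * s) - 1‖)
        (fun _ _ => norm_nonneg _) (Finset.mem_range.2 (by omega)))
    (by rw [← hw]) hRmono (by simp only [R]; simp; positivity)
    (fun m => by
      simp only [R]
      rw [Finset.sum_range_succ (n := m + 4)]
      have e2 : m + 4 - 2 = m + 2 := by omega
      have e3 : m + 4 - 3 = m + 1 := by omega
      have e4 : m + 4 - 4 = m := by omega
      rw [e2, e3, e4]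
      simp only [δ]
      push_cast
      apply le_of_eq
      ring)
    (fun m hm k p π₀ hπ₀ hc hpm => by
      refine (norm_expSum_base_le (η := η) hψ (lt_one_of_root hψ hroot).le hm
        (Finset.single_le_sum (f := fun m : ℕ => ‖Complex.exp (-(m * s)) - 1‖)
        (fun _ _ => norm_nonneg _) (Finset.mem_range.2 (by omega))) hπ₀ hc hpm).trans ?_
      refine le_trans (le_of_eq ?_) (hRmono (Nat.zero_le m))
      simp [R])
    n n 0 le_rfl 1 (by simp [perms]) (isCut_zero _) (by omega)
  refine main.trans ?_
  refine mul_le_mul_of_nonneg_left ?_ (by positivity)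
  simp only [R]
  gcongr
  -- The factor 12 is `3 + 4 + 5`, from the shifts 2, 3 and 4.
  rw [Finset.sum_add_distrib, Finset.sum_add_distrib]
  have h2 := sum_shift_le hδ0 hD 2 n
  have h3 := sum_shift_le hδ0 hD 3 n
  have h4 := sum_shift_le hδ0 hD 4 n
  push_cast at h2 h3 h4
  linarith

theorem tendsto_expSum {c : ℕ} (hcc : c ≤ 4) (hψ : 0 < ψ)
    (hroot : ψ + ψ ^ 2 + ψ ^ 3 = 1) (h : 4 * ψ ^ 3 + 3 * ψ ^ 4 + 2 * ψ ^ 5 = 1)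
    (hM : M = 3 * (4 * ψ ^ 3) + 4 * (3 * ψ ^ 4) + 5 * (2 * ψ ^ 5))
    (hV : V = 3 ^ 2 * (4 * ψ ^ 3) + 4 ^ 2 * (3 * ψ ^ 4) + 5 ^ 2 * (2 * ψ ^ 5) - M ^ 2)
    (hM0 : 0 < M) (hV0 : 0 < V) (hσ : 0 < σ) (hσ2 : σ ^ 2 = Real.log 9 ^ 2 * (V / M ^ 3))
    (hμ : μ = Real.log 9 / M) (θ : ℝ) :
    Tendsto (fun n : ℕ => Complex.exp (-(Complex.I * (θ * μ * √n / σ))) *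
      expSum c n (θ / (σ * √n)) 0 (1 : Equiv.Perm (Fin n)) / trib n) atTop
      (𝓝 (Complex.exp (-(θ ^ 2 / 2)))) := by
  obtain ⟨D, hD0, hD⟩ := exists_sum_abs_le hψ hroot
  obtain ⟨d, hd, hdle⟩ := exists_le_scaled hψ hroot
  set L := Real.log 9 with hL
  have hL0 : 0 < L := Real.log_pos (by norm_num)
  set b := scaledLim ψ with hb
  let t : ℕ → ℝ := fun n => θ / (σ * √n)
  let w : ℕ → ℂ := fun n => Complex.I * t n * L
  have ht0 : Tendsto t atTop (𝓝 0) := by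
    refine Tendsto.const_div_atTop ?_ θ
    refine Tendsto.const_mul_atTop hσ ?_
    exact Real.tendsto_sqrt_atTop.comp tendsto_natCast_atTop_atTop
  have hw0 : Tendsto w atTop (𝓝 0) := by
    have : Tendsto (fun n => Complex.I * (t n : ℂ) * L) atTop (𝓝 (Complex.I * ((0 : ℝ) : ℂ) * L)) :=
      (((Complex.continuous_ofReal.tendsto 0).comp ht0).const_mul _).mul_const _
    simpa using this
  have hnt : ∀ n : ℕ, 1 ≤ n → n * t n ^ 2 = θ ^ 2 / σ ^ 2 := fun n hn => by
    have hn' : (0 : ℝ) < n := by exact_mod_cast hn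
    simp only [t]
    rw [div_pow, mul_pow, Real.sq_sqrt hn'.le]
    field_simp
  let A : ℂ → ℂ := fun w => 4 * (ψ : ℂ) ^ 3 * Complex.exp (w - (3 : ℕ) * root M V w) +
          3 * ψ ^ 4 * Complex.exp (w - (4 : ℕ) * root M V w) +
          2 * ψ ^ 5 * Complex.exp (w - (5 : ℕ) * root M V w) - 1
  let err : ℕ → ℝ := fun n =>
    7 * ∑ m ∈ Finset.range 5, ‖Complex.exp (-(m * root M V (w n))) - 1‖ + 49 * |t n| +
        n * (|b| * ‖A (w n)‖) +
        (∑ l ∈ Finset.range 6, ‖Complex.exp (w n - l * root M V (w n)) - 1‖) * (12 * D)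
  have herr : Tendsto err atTop (𝓝 0) := by
    have hroot0 := continuous_root M V
    have t1 : Tendsto (fun n => ∑ m ∈ Finset.range 5,
        ‖Complex.exp (-(m * root M V (w n))) - 1‖) atTop (𝓝 0) := by
      have hc : Continuous fun w : ℂ => ∑ m ∈ Finset.range 5,
        ‖Complex.exp (-(m * root M V w)) - 1‖ := by fun_prop
      have := (hc.tendsto 0).comp hw0
      simpa [root_zero, Function.comp_def] using this
    have t2 : Tendsto (fun n => ∑ l ∈ Finset.range 6,
        ‖Complex.exp (w n - l * root M V (w n)) - 1‖) atTop (𝓝 0) := by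
      have hc : Continuous fun w : ℂ => ∑ l ∈ Finset.range 6,
        ‖Complex.exp (w - l * root M V w) - 1‖ := by fun_prop
      have := (hc.tendsto 0).comp hw0
      simpa [root_zero, Function.comp_def] using this
    have t3 : Tendsto (fun n => |t n|) atTop (𝓝 0) := by simpa using ht0.abs
    -- Here the third-order expansion is needed: `n * ‖w n‖²` is constant, so an error `O(w³)`
    -- survives summation over `n` steps.
    have t4 : Tendsto (fun n : ℕ => (n : ℝ) * ‖A (w n)‖) atTop (𝓝 0) := by
      have hA : A =O[𝓝 0] (fun w => w ^ 3) := by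
        have := expansion_isBigO (p₃ := 4 * ψ ^ 3) (p₄ := 3 * ψ ^ 4) (p₅ := 2 * ψ ^ 5) h hM hV
          hM0.ne'
        refine this.congr_left fun w => ?_
        simp only [A]
        push_cast
        ring
      have hA2 : A =o[𝓝 0] (fun w : ℂ => w ^ 2) :=
        hA.trans_isLittleO (Asymptotics.isLittleO_pow_pow (by norm_num))
      have h3 := (hA2.comp_tendsto hw0).norm_norm
      have h4 : (fun n : ℕ => (n : ℝ) * ‖A (w n)‖) =o[atTop]
          (fun n : ℕ => (n : ℝ) * ‖(w n) ^ 2‖) :=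
        (Asymptotics.isBigO_refl (fun n : ℕ => (n : ℝ)) atTop).mul_isLittleO h3
      have h5 : (fun n : ℕ => (n : ℝ) * ‖(w n) ^ 2‖) =ᶠ[atTop]
          fun _ => θ ^ 2 / σ ^ 2 * L ^ 2 := by
        filter_upwards [eventually_ge_atTop 1] with n hn
        rw [← hnt n hn]
        simp only [w, norm_pow, norm_mul, Complex.norm_I, Complex.norm_real,
          Real.norm_eq_abs, mul_pow, sq_abs]
        ring
      have h6 := h4.trans_eventuallyEq h5
      exact (Asymptotics.isLittleO_one_iff ℝ).1
        (h6.trans_isBigO (Asymptotics.isBigO_const_const _ one_ne_zero _))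
    have := (((t1.const_mul 7).add (t3.const_mul 49)).add (t4.const_mul |b|)).add
      (t2.mul_const (12 * D))
    simp only [mul_zero, zero_mul, add_zero] at this
    refine this.congr fun n => ?_
    simp only [err]
    ring
  have hVM : 0 ≤ V / (2 * M ^ 3) := by positivity
  have hexact : ∀ n : ℕ, 1 ≤ n → Complex.exp (-(Complex.I * (θ * μ * √n / σ))) *
      expSum c n (t n) 0 (1 : Equiv.Perm (Fin n)) / trib n -
      Complex.exp (-(θ ^ 2 / 2)) = Complex.exp (-(θ ^ 2 / 2)) *
        ((expSum c n (t n) 0 (1 : Equiv.Perm (Fin n)) *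
          (ψ * Complex.exp (-root M V (w n))) ^ n - scaled ψ n) / scaled ψ n) := by
    intro n hn
    have hn' : (0 : ℝ) < n := by exact_mod_cast hn
    have hsq : (√n : ℝ) ≠ 0 := (Real.sqrt_pos.2 hn').ne'
    -- The linear term of `root` gives the centring by `μ n`, the quadratic term the Gaussian
    -- exponent; this is where `μ` and `σ` are determined.
    have hsn : (n : ℂ) * root M V (w n) = Complex.I * (θ * μ * √n / σ) + -(θ ^ 2 / 2) := by
      have r1 : (n : ℝ) * (t n * L / M) = θ * μ * √n / σ := by
        have : (n : ℝ) = √n * √n := (Real.mul_self_sqrt hn'.le).symm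
        simp only [t]
        rw [hμ]
        nth_rw 1 [this]
        field_simp
      have r2 : (V / (2 * M ^ 3)) * L ^ 2 * (n * t n ^ 2) = θ ^ 2 / 2 := by
        rw [hnt n hn, hσ2]
        field_simp
      have r1' : (n : ℂ) * (t n * L / M) = θ * μ * √n / σ := by exact_mod_cast r1
      have r2' : (V / (2 * M ^ 3)) * L ^ 2 * (n * t n ^ 2) = (θ : ℂ) ^ 2 / 2 := by
        exact_mod_cast r2
      rw [← r1', ← r2', root]
      simp only [w]
      linear_combination (V / (2 * M ^ 3) * t n ^ 2 * L ^ 2 * n : ℂ) * Complex.I_sq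
    have htr : (trib n : ℂ) ≠ 0 := by exact_mod_cast (trib_pos n).ne'
    have hψn : (ψ : ℂ) ^ n ≠ 0 := pow_ne_zero _ (by exact_mod_cast hψ.ne')
    have e : Complex.exp (-(Complex.I * (θ * μ * √n / σ))) =
        Complex.exp (-(θ ^ 2 / 2)) * Complex.exp (-root M V (w n)) ^ n := by
      rw [← Complex.exp_nat_mul, ← Complex.exp_add, mul_neg, hsn]
      ring_nf
    rw [e, mul_pow, scaled]
    push_cast
    field_simp
  rw [tendsto_iff_norm_sub_tendsto_zero]
  have hfin : Tendsto (fun n => Real.exp (-(θ ^ 2 / 2)) *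
      (Real.exp (5 * (V / (2 * M ^ 3)) * (θ ^ 2 / σ ^ 2 * L ^ 2)) * err n / d)) atTop (𝓝 0) := by
    have := ((herr.const_mul (Real.exp (5 * (V / (2 * M ^ 3)) * (θ ^ 2 / σ ^ 2 * L ^ 2)))).div_const
      d).const_mul (Real.exp (-(θ ^ 2 / 2)))
    simpa using this
  refine squeeze_zero' (Eventually.of_forall fun _ => norm_nonneg _) ?_ hfin
  filter_upwards [eventually_ge_atTop 1] with n hn
  have hb1 := norm_expSum_perms_sub_le (M := M) (V := V) hcc hψ hroot h hVM hD n (t n) (w := w n) rfl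
  have hBn : Real.exp (5 * (V / (2 * M ^ 3)) * (t n * L) ^ 2) ^ n =
      Real.exp (5 * (V / (2 * M ^ 3)) * (θ ^ 2 / σ ^ 2 * L ^ 2)) := by
    rw [← Real.exp_nat_mul, ← hnt n hn]
    ring_nf
  rw [← hL, hBn] at hb1
  have := hexact n hn
  simp only [t] at this
  rw [this, norm_mul, norm_div, Complex.norm_real, Real.norm_of_nonneg (scaled_pos hψ n).le]
  have hn1 : ‖Complex.exp (-((θ : ℂ) ^ 2 / 2))‖ = Real.exp (-(θ ^ 2 / 2)) := by
    rw [← Complex.norm_of_nonneg (Real.exp_pos _).le]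
    push_cast
    rfl
  rw [hn1]
  have herr0 : 0 ≤ err n := by simp only [err]; positivity
  gcongr
  exact hdle n

end Limit

/-! ### From exponential sums to convergence in distribution. -/

section Distribution

variable {σ μ : ℝ}

theorem integral_uniform {n : ℕ} (f : Equiv.Perm (Fin n) → ℂ) :
    ∫ π, f π ∂uniform n = (∑ π ∈ perms n, f π) / trib n := by
  have hcard : (perms n).card = trib n := by
    rw [← cyl_zero 1]
    exact card_cyl n 0 1 (by simp [perms]) (isCut_zero _) (by omega)
  rw [uniform, PMF.integral_eq_sum, ← Finset.sum_subset (Finset.subset_univ (perms n)),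
    Finset.sum_div]
  · refine Finset.sum_congr rfl fun π hπ => ?_
    rw [PMF.uniformOfFinset_apply, if_pos hπ, hcard]
    simp [div_eq_inv_mul]
  · intro π _ hπ
    rw [PMF.uniformOfFinset_apply, if_neg hπ]
    simp

theorem charFun_map_log_T (c n : ℕ) (θ : ℝ) :
    charFun ((uniform n).map fun π => (Real.log (T n c π) - μ * n) / (σ * √n)) θ =
      Complex.exp (-(Complex.I * (θ * μ * √n / σ))) *
        expSum c n (θ / (σ * √n)) 0 (1 : Equiv.Perm (Fin n)) / trib n := by
  rw [charFun_apply_real, integral_map (measurable_of_countable _).aemeasurable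
    (by fun_prop), integral_uniform, expSum, cyl_zero, Finset.mul_sum]
  congr 1
  refine Finset.sum_congr rfl fun π hπ => ?_
  rw [T_eq_weight hπ, ← Complex.exp_add]
  congr 1
  have h : (n : ℂ) / √n = √n := by exact_mod_cast Real.div_sqrt (x := (n : ℝ))
  push_cast
  rw [mul_assoc _ (_ / _), sub_div, mul_div_mul_comm, h]
  ring

theorem tendstoInDistribution_log_T {c : ℕ} (hcc : c ≤ 4) {ψ M V : ℝ} (hψ : 0 < ψ)
    (hroot : ψ + ψ ^ 2 + ψ ^ 3 = 1) (h : 4 * ψ ^ 3 + 3 * ψ ^ 4 + 2 * ψ ^ 5 = 1)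
    (hM : M = 3 * (4 * ψ ^ 3) + 4 * (3 * ψ ^ 4) + 5 * (2 * ψ ^ 5))
    (hV : V = 3 ^ 2 * (4 * ψ ^ 3) + 4 ^ 2 * (3 * ψ ^ 4) + 5 ^ 2 * (2 * ψ ^ 5) - M ^ 2)
    (hM0 : 0 < M) (hV0 : 0 < V) (hσ : 0 < σ) (hσ2 : σ ^ 2 = Real.log 9 ^ 2 * (V / M ^ 3))
    (hμ : μ = Real.log 9 / M) :
    TendstoInDistribution
      (fun (n : ℕ) (π : Equiv.Perm (Fin n)) => (Real.log (T n c π) - μ * n) / (σ * √n))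
      atTop (id : ℝ → ℝ) uniform (gaussianReal 0 1) where
  forall_aemeasurable n := (measurable_of_countable _).aemeasurable
  aemeasurable_limit := aemeasurable_id
  tendsto := by
    refine ProbabilityMeasure.tendsto_iff_tendsto_charFun.2 fun θ => ?_
    simp only [ProbabilityMeasure.coe_mk, Measure.map_id, charFun_gaussianReal,
      charFun_map_log_T]
    convert tendsto_expSum hcc hψ hroot h hM hV hM0 hV0 hσ hσ2 hμ θ using 2
    push_cast
    ring_nf

end Distribution

end TwoFibonacci

/-! ### Assembly, with `φ = ψ⁻¹`. -/

theorem mainTheorem7 (c : ℕ) (hc : c ≤ 4) :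
    ∃ φ m v μ σ : ℝ,
      φ ^ 3 = φ ^ 2 + φ + 1 ∧
      4 / φ ^ 3 + 3 / φ ^ 4 + 2 / φ ^ 5 = 1 ∧
      m = 3 * (4 / φ ^ 3) + 4 * (3 / φ ^ 4) + 5 * (2 / φ ^ 5) ∧
      v = 3 ^ 2 * (4 / φ ^ 3) + 4 ^ 2 * (3 / φ ^ 4) + 5 ^ 2 * (2 / φ ^ 5) - m ^ 2 ∧
      μ = Real.log 9 / m ∧
      0 < σ ∧ σ ^ 2 = Real.log 9 ^ 2 * (v / m ^ 3) ∧
      |μ - 0.6365| ≤ 0.00005 ∧ |σ ^ 2 - 0.0514| ≤ 0.00005 ∧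
      TendstoInDistribution
        (fun (n : ℕ) (π : Equiv.Perm (Fin n)) =>
          (Real.log (TwoFibonacci.T n c π) - μ * n) / (σ * √n))
        atTop (id : ℝ → ℝ) TwoFibonacci.uniform (gaussianReal 0 1) := by
  obtain ⟨ψ, h1, h2, hroot⟩ := TwoFibonacci.exists_root
  have hψ : 0 < ψ := by linarith
  have hsum : 4 * ψ ^ 3 + 3 * ψ ^ 4 + 2 * ψ ^ 5 = 1 := by
    -- The step polynomial minus 1 factors as `(1 + ψ + 2ψ²)(ψ + ψ² + ψ³ - 1)`.
    linear_combination (1 + ψ + 2 * ψ ^ 2) * hroot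
  set M := 3 * (4 * ψ ^ 3) + 4 * (3 * ψ ^ 4) + 5 * (2 * ψ ^ 5) with hM
  set V := 3 ^ 2 * (4 * ψ ^ 3) + 4 ^ 2 * (3 * ψ ^ 4) + 5 ^ 2 * (2 * ψ ^ 5) - M ^ 2 with hV
  obtain ⟨⟨hm1, hm2⟩, hv1, hv2⟩ := TwoFibonacci.mean_variance_bounds h1 h2 hM hV
  obtain ⟨hb1, hb2⟩ := TwoFibonacci.numerical_bounds hm1 hm2 hv1 hv2
  have hM0 : 0 < M := by linarith
  have hV0 : 0 < V := by linarith
  have hL0 : 0 < Real.log 9 := Real.log_pos (by norm_num)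
  have hpos : 0 < Real.log 9 ^ 2 * (V / M ^ 3) := by positivity
  have hσ2 := Real.sq_sqrt hpos.le
  have hinv : ∀ (a : ℝ) (k : ℕ), a / ψ⁻¹ ^ k = a * ψ ^ k := fun a k => by
    rw [inv_pow, div_inv_eq_mul]
  refine ⟨ψ⁻¹, M, V, Real.log 9 / M, √(Real.log 9 ^ 2 * (V / M ^ 3)), ?_, ?_, ?_, ?_, rfl,
    Real.sqrt_pos.2 hpos, hσ2, hb1, by rwa [hσ2],
    TwoFibonacci.tendstoInDistribution_log_T hc hψ hroot hsum hM hV hM0 hV0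
      (Real.sqrt_pos.2 hpos) hσ2 rfl⟩
  · field_simp
    linear_combination -hroot
  · simpa only [hinv] using hsum
  · simpa only [hinv] using hM
  · simpa only [hinv] using hV
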